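/- Let $K$ be a field of characteristic $0$. A multigraph on a vertex set $V$ is a map $m$ from the set of pairs (two-element subsets) of $V$ to $\mathbb N$; its number of edges is $\sum_{\{i,j\}} m_{\{i,j\}}$, it is simple if $m$ takes only the values $0,1$, and two multigraphs are isomorphic if a bijection between their vertex sets carries one to the other; an unlabelled multigraph is an isomorphism class. Connected components are those of the simple graph whose edges are the pairs with $m_{\{i,j\}}\neq 0$, and a vertex is isolated if all pairs containing it have multiplicity $0$. For $n\in\mathbb N$ let $P_n=K[x_{\{i,j\}}]$ be the polynomial algebra in variables indexed by the pairs of $\{1,\dots,n\}$. Let $\mathrm{Inv}[n]\subseteq P_n$ be the subalgebra of polynomials invariant under all permutations of the vertices. For a multigraph $m$ on $\{1,\dots,n\}$ put $x^m=\prod x_{\{i,j\}}^{m_{\{i,j\}}}$ and $x^{\circledast m}=\sum_{m'}x^{m'}$, where $m'$ runs through the orbit of $m$ under $\mathfrak S_n$ (each element once). Let $\mathrm{Rec}[n]$ be the subalgebra generated by the $x^{\circledast m}$ for which $m$ has at least one isolated vertex; $m$ is called algebraically reconstructible if $x^{\circledast m}\in\mathrm{Rec}[n]$. Write $\mathrm{Inv}[n,d]$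 and $\mathrm{Rec}[n,d]$ for the components of degree $d$. Let $h_{n,d}$ be the number of unlabelled multigraphs with $n$ vertices and $d$ edges, and $f_{n,d}$ the number of unlabelled multigraphs with $d$ edges (on any number of vertices), without isolated vertices, all of whose connected components have at most $n-1$ vertices. Then: 1. $\dim_K\mathrm{Rec}[11,18]\le f_{11,18}<\dim_K\mathrm{Inv}[11,18]=h_{11,18}$. 2. Consequently $\mathrm{Rec}[11]\subsetneq\mathrm{Inv}[11]$, some multigraph with $11$ vertices and $18$ edges is not algebraically reconstructible, and the number of unlabelled multigraphs with $11$ vertices and $18$ edges that are not algebraically reconstructible is at least $h_{11,18}-f_{11,18}$. 3. Let $I\subseteq P_{13}$ be the ideal generated by the $x_{\{i,j\}}^2$. The image of $\mathrm{Rec}[13,17]$ in $P_{13}/I$ has strictly smaller dimension than the image of $\mathrm{Inv}[13,17]$, and there is a simple graph with $13$ vertices and $17$ edges that is not algebraically reconstructible. -/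

import Mathlib

open MvPolynomial

noncomputable section

namespace GraphRec

/-- Unordered pairs of distinct elements of `V`. -/
abbrev Pair (V : Type*) : Type _ := {e : Sym2 V // ¬ e.IsDiag}

/-- The bijection on pairs induced by a bijection of vertices. -/
def pairEquiv {V W : Type*} (σ : V ≃ W) : Pair V ≃ Pair W where
  toFun e := ⟨Sym2.map σ e.1, by
    rw [Sym2.isDiag_map σ.injective]; exact e.2⟩
  invFun e := ⟨Sym2.map σ.symm e.1, by
    rw [Sym2.isDiag_map σ.symm.injective]; exact e.2⟩
  left_inv e := by
    apply Subtype.ext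
    simp [Sym2.map_map]
  right_inv e := by
    apply Subtype.ext
    simp [Sym2.map_map]

/-- A multigraph on the vertex set `V`: every pair carries a multiplicity in `ℕ`. The number of
edges, counted with multiplicity, is `Finsupp.degree m`. -/
abbrev Multigraph (V : Type*) : Type _ := Pair V →₀ ℕ

namespace Multigraph

variable {V W : Type*}

/-- Transport of a multigraph along a bijection of vertices. -/
def relabel (σ : V ≃ W) (m : Multigraph V) : Multigraph W :=
  Finsupp.equivMapDomain (pairEquiv σ) m

/-- The vertex `v` is incident to no edge. -/
def IsIsolated (m : Multigraph V) (v : V) : Prop :=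
  ∀ e : Pair V, v ∈ e.1 → m e = 0

/-- All multiplicities are `0` or `1`. -/
def IsSimple (m : Multigraph V) : Prop :=
  ∀ e : Pair V, m e ≤ 1

/-- The underlying simple graph, which has the same connected components. -/
def underlying (m : Multigraph V) : SimpleGraph V :=
  SimpleGraph.fromEdgeSet {e | ∃ h : ¬ e.IsDiag, m ⟨e, h⟩ ≠ 0}

end Multigraph

/-- Isomorphism of multigraphs on the vertex sets `Fin N`, for all `N` at once. -/
def isoSetoid : Setoid (Σ N : ℕ, Multigraph (Fin N)) where
  r g g' := ∃ σ : Fin g.1 ≃ Fin g'.1, g.2.relabel σ = g'.2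
  iseqv :=
    { refl := fun g => ⟨Equiv.refl _, by
        ext e
        simp [Multigraph.relabel, Finsupp.equivMapDomain_apply, pairEquiv]⟩
      symm := by
        rintro g g' ⟨σ, h⟩
        refine ⟨σ.symm, ?_⟩
        rw [← h]
        ext e
        simp [Multigraph.relabel, Finsupp.equivMapDomain_apply, pairEquiv, Sym2.map_map]
      trans := by
        rintro g g' g'' ⟨σ, h⟩ ⟨τ, h'⟩
        refine ⟨σ.trans τ, ?_⟩
        rw [← h', ← h]
        ext e
        simp [Multigraph.relabel, Finsupp.equivMapDomain_apply, pairEquiv, Sym2.map_map] }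

/-- The number of isomorphism classes (unlabelled multigraphs) having a representative in `S`. -/
def classCount (S : Set (Σ N : ℕ, Multigraph (Fin N))) : ℕ :=
  (Quotient.mk isoSetoid '' S).ncard

/-- The number of unlabelled multigraphs with `n` vertices and `d` edges. -/
def hCount (n d : ℕ) : ℕ :=
  classCount {g | g.1 = n ∧ g.2.degree = d}

/-- The number of unlabelled multigraphs with `d` edges (and any number of vertices), without
isolated vertices, all of whose connected components have at most `n - 1` vertices. -/
def fCount (n d : ℕ) : ℕ :=
  classCount {g | g.2.degree = d ∧ (∀ v, ¬ g.2.IsIsolated v) ∧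
    ∀ c : g.2.underlying.ConnectedComponent, c.supp.ncard < n}

section Algebra

variable (K : Type*) [Field K] (n : ℕ)

/-- Polynomials in the variables `x_{i,j}` indexed by the pairs of vertices. -/
abbrev Pol : Type _ := MvPolynomial (Pair (Fin n)) K

/-- The algebra of polynomials invariant under all permutations of the vertices. -/
def Inv : Subalgebra K (Pol K n) where
  carrier := {p | ∀ σ : Equiv.Perm (Fin n), rename (pairEquiv σ) p = p}
  mul_mem' hp hq σ := by rw [map_mul, hp σ, hq σ]
  add_mem' hp hq σ := by rw [map_add, hp σ, hq σ]
  algebraMap_mem' r σ := AlgHom.commutes _ r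

variable {n} in
/-- The sum of the monomials `x^m'`, each once, for `m'` in the orbit of `m`. -/
def orbitSum (m : Multigraph (Fin n)) : Pol K n :=
  ∑ m' ∈ Finset.univ.image (fun σ : Equiv.Perm (Fin n) => m.relabel σ), monomial m' 1

/-- The algebra generated by the orbit sums of the multigraphs with at least one isolated
vertex. -/
def Rec : Subalgebra K (Pol K n) :=
  Algebra.adjoin K {p | ∃ m : Multigraph (Fin n), (∃ v, m.IsIsolated v) ∧ p = orbitSum K m}

variable {n} in
/-- A multigraph is algebraically reconstructible if its orbit sum belongs to `Rec`. -/
def IsAlgRec (m : Multigraph (Fin n)) : Prop :=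
  orbitSum K m ∈ Rec K n

variable {K n} in
/-- The component of degree `d` of a (graded) subalgebra of the polynomial algebra. -/
def component (A : Subalgebra K (Pol K n)) (d : ℕ) : Submodule K (Pol K n) :=
  Subalgebra.toSubmodule A ⊓ homogeneousSubmodule (Pair (Fin n)) K d

/-- The ideal generated by the squares of the variables. -/
def squareIdeal : Ideal (Pol K n) :=
  Ideal.span (Set.range fun e : Pair (Fin n) => (X e ^ 2 : Pol K n))

variable {K n} in
/-- The image of the component of degree `d` of `A` modulo the squares of the variables. For
`A = Inv K n` this is the component of degree `d` of the algebra of simple graphs. -/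
def simpleComponent (A : Subalgebra K (Pol K n)) (d : ℕ) :
    Submodule K (Pol K n ⧸ squareIdeal K n) :=
  (component A d).map (Ideal.Quotient.mkₐ K (squareIdeal K n)).toLinearMap

end Algebra

end GraphRec

end

/-! The argument compares dimensions. `Inv` has the orbit sums as a basis, so its component of
degree `d` has dimension `h_{n,d}`. On the other side, in characteristic `0` the algebra `Rec` lies
in the algebra generated by the orbit sums of connected multigraphs with 2 to `n - 1` vertices,
completed by isolated vertices. Indeed, multiplying the symmetrized monomials of two disjoint pieces
gives a nonzero multiple of that of their disjoint union, plus terms with fewer non-isolated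
vertices; induction on that number peels off components (`symSum_mem_adjoin`). Hence the degree `d`
part of `Rec` is spanned by products indexed by multisets of connected classes with `d` edges in
total, and such multisets are exactly the multigraphs counted by `f_{n,d}` (`component_Rec_le_span`,
`fCount_eq`). Modulo the squares of the variables every product with a non-simple factor vanishes,
so the same bound holds with simple connected graphs only.

What remains is numerical: `f < h` for `(11, 18)`, and its simple analogue for `(13, 17)`.
Burnside's lemma gives the numbers of all classes, by summing over cycle types. A multigraph is its
multiset of components, so the numbers of connected classes are related to these by the Euler
transform; a second Euler transform, forgetting the number of vertices and restricting the size of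
components, gives `f`. The counting of functions fixed by a permutation and both transforms rest on
one identity, the logarithmic derivative of an Euler product (`mul_ncard_msSet`).

The individual non-reconstructible graphs follow by counting: the orbit sums of reconstructible
classes are linearly independent in `Rec`, so there are at most as many such classes as the
dimension allows. -/

noncomputable section
namespace GraphRec

/-! ### Multiplicity functions -/

namespace Multigraph

section Mul
variable {V W : Type*}

open Classical in
/-- The multiplicity of the pair `{u, v}`, as a function of two vertices (zero on the diagonal). -/
def mul (m : Multigraph V) (u v : V) : ℕ :=
  if h : u = v then 0 else m ⟨s(u, v), by simpa using h⟩

theorem mul_self (m : Multigraph V) (u : V) : m.mul u u = 0 := by simp [mul]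

theorem mul_of_ne (m : Multigraph V) {u v : V} (h : ¬ s(u, v).IsDiag) :
    m.mul u v = m ⟨s(u, v), h⟩ := by
  have : u ≠ v := by simpa using h
  simp [mul, this]

theorem mul_comm (m : Multigraph V) (u v : V) : m.mul u v = m.mul v u := by
  by_cases h : u = v
  · subst h; rfl
  · rw [mul_of_ne m (by simpa using h), mul_of_ne m (by simpa using Ne.symm h)]
    congr 2
    exact Sym2.eq_swap

theorem ext_mul {m m' : Multigraph V} (h : ∀ u v, m.mul u v = m'.mul u v) : m = m' := by
  ext ⟨e, he⟩
  induction e with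
  | _ u v => rw [← mul_of_ne m he, ← mul_of_ne m' he, h]

/-- The multigraph with given multiplicities. -/
def ofMul [Finite V] (f : V → V → ℕ) (hf : ∀ u v, f u v = f v u) : Multigraph V :=
  Finsupp.equivFunOnFinite.symm fun e => Sym2.lift ⟨f, hf⟩ e.1

theorem mul_ofMul [Finite V] (f : V → V → ℕ) (hf : ∀ u v, f u v = f v u) (h0 : ∀ u, f u u = 0)
    (u v : V) : (ofMul f hf).mul u v = f u v := by
  by_cases h : u = v
  · subst h; rw [mul_self, h0]
  · rw [mul_of_ne _ (by simpa using h)]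
    rfl

theorem mul_relabel (σ : V ≃ W) (m : Multigraph V) (u v : V) :
    (m.relabel σ).mul (σ u) (σ v) = m.mul u v := by
  by_cases h : u = v
  · subst h; rw [mul_self, mul_self]
  · rw [mul_of_ne _ (by simpa using h), mul_of_ne m (by simpa using h), relabel,
      Finsupp.equivMapDomain_apply]
    congr 1
    apply Subtype.ext
    simp [pairEquiv]

theorem mul_relabel' (σ : V ≃ W) (m : Multigraph V) (u v : W) :
    (m.relabel σ).mul u v = m.mul (σ.symm u) (σ.symm v) := by
  rw [← mul_relabel σ m]; simp

theorem relabel_eq_iff (σ : V ≃ W) (m : Multigraph V) (m' : Multigraph W) :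
    m.relabel σ = m' ↔ ∀ u v, m'.mul (σ u) (σ v) = m.mul u v := by
  constructor
  · rintro rfl; exact mul_relabel σ m
  · intro h
    refine ext_mul fun u v => ?_
    rw [mul_relabel', ← h]; simp

theorem mul_add (m m' : Multigraph V) (u v : V) : (m + m').mul u v = m.mul u v + m'.mul u v := by
  by_cases h : u = v
  · subst h; simp [mul_self]
  · simp [mul, h]

theorem mul_zero (u v : V) : (0 : Multigraph V).mul u v = 0 := by
  by_cases h : u = v <;> simp [mul, h]

theorem isIsolated_iff (m : Multigraph V) (v : V) : m.IsIsolated v ↔ ∀ u, m.mul v u = 0 := by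
  constructor
  · intro h u
    by_cases huv : v = u
    · subst huv; exact mul_self m v
    · rw [mul_of_ne m (by simpa using huv)]
      exact h _ (by simp)
  · rintro h ⟨e, he⟩ hv
    obtain ⟨u, rfl⟩ := Sym2.mem_iff_exists.1 hv
    rw [← mul_of_ne m he, h]

theorem isSimple_iff (m : Multigraph V) : m.IsSimple ↔ ∀ u v, m.mul u v ≤ 1 := by
  constructor
  · intro h u v
    by_cases huv : u = v
    · subst huv; simp [mul_self]
    · rw [mul_of_ne m (by simpa using huv)]
      exact h _
  · rintro h ⟨e, he⟩
    induction e with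
    | _ u v => rw [← mul_of_ne m he]; exact h u v

theorem underlying_adj (m : Multigraph V) (u v : V) : m.underlying.Adj u v ↔ m.mul u v ≠ 0 := by
  rw [underlying, SimpleGraph.fromEdgeSet_adj]
  constructor
  · rintro ⟨⟨h, h'⟩, -⟩
    rwa [mul_of_ne m h]
  · intro h
    have huv : u ≠ v := by rintro rfl; exact h (mul_self m u)
    have hd : ¬ s(u, v).IsDiag := by simpa using huv
    exact ⟨⟨hd, by rwa [mul_of_ne m hd] at h⟩, huv⟩

/-- Each unordered pair comes from exactly two ordered ones, and the diagonal contributes nothing.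
Facts about the number of edges thus become facts about double sums over vertices, free of `Sym2`.
-/
theorem two_mul_degree [Fintype V] (m : Multigraph V) :
    2 * m.degree = ∑ u, ∑ v, m.mul u v := by
  classical
  have h1 : m.degree = ∑ e : Pair V, m e := Finsupp.degree_eq_sum m
  have h2 : ∑ u, ∑ v, m.mul u v = ∑ p : {p : V × V // ¬ s(p.1, p.2).IsDiag}, m ⟨s(p.1.1, p.1.2), p.2⟩ := by
    rw [← Finset.sum_product', ← Finset.sum_filter_add_sum_filter_not _
      (fun p : V × V => ¬ s(p.1, p.2).IsDiag), Finset.sum_subtype _ (p := fun p : V × V => ¬ s(p.1, p.2).IsDiag) (by simp)]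
    have : ∑ x ∈ (Finset.univ ×ˢ Finset.univ : Finset (V × V)) with ¬¬ s(x.1, x.2).IsDiag, m.mul x.1 x.2 = 0 := by
      refine Finset.sum_eq_zero fun p hp => ?_
      have : p.1 = p.2 := by simpa using hp
      rw [this, mul_self]
    rw [this, add_zero]
    exact Finset.sum_congr rfl fun p _ => mul_of_ne m p.2
  rw [h1, h2, ← Finset.sum_fiberwise_of_maps_to (s := Finset.univ) (t := Finset.univ)
    (g := fun p : {p : V × V // ¬ s(p.1, p.2).IsDiag} => (⟨s(p.1.1, p.1.2), p.2⟩ : Pair V)) (by simp),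
    Finset.mul_sum]
  refine Finset.sum_congr rfl ?_
  rintro ⟨e, he⟩ -
  induction e with
  | _ u v =>
    have huv : u ≠ v := by simpa using he
    have : (Finset.univ.filter fun p : {p : V × V // ¬ s(p.1, p.2).IsDiag} =>
        (⟨s(p.1.1, p.1.2), p.2⟩ : Pair V) = ⟨s(u, v), he⟩) =
        {⟨(u, v), he⟩, ⟨(v, u), by simpa using huv.symm⟩} := by
      ext ⟨⟨a, b⟩, hab⟩
      simp
    rw [this, Finset.sum_pair (by simp [huv])]
    simp only [two_mul]
    congr 3
    exact Sym2.eq_swap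

theorem degree_relabel [Fintype V] [Fintype W] (σ : V ≃ W) (m : Multigraph V) :
    (m.relabel σ).degree = m.degree := by
  have h : 2 * (m.relabel σ).degree = 2 * m.degree := by
    rw [two_mul_degree, two_mul_degree, ← σ.sum_comp]
    refine Finset.sum_congr rfl fun u _ => ?_
    rw [← σ.sum_comp]
    exact Finset.sum_congr rfl fun v _ => mul_relabel σ m u v
  omega

theorem isSimple_relabel (σ : V ≃ W) (m : Multigraph V) :
    (m.relabel σ).IsSimple ↔ m.IsSimple := by
  simp_rw [isSimple_iff, mul_relabel', σ.symm.surjective.forall]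

/-- The multigraph induced on the vertices in `S`. -/
def restrict [Finite V] (m : Multigraph V) (S : Set V) : Multigraph S :=
  ofMul (fun a b => m.mul a b) fun _ _ => mul_comm m _ _

theorem mul_restrict [Finite V] (m : Multigraph V) (S : Set V) (a b : S) :
    (m.restrict S).mul a b = m.mul a b :=
  mul_ofMul (fun a b : S => m.mul a b) _ (fun _ => mul_self m _) a b

end Mul

end Multigraph

open Multigraph

/-! ### Isomorphism classes -/

/-- Unlabelled multigraphs. -/
abbrev Cls : Type := Quotient isoSetoid

/-- The isomorphism class of a multigraph on a finite vertex set. -/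
def cls {V : Type} [Fintype V] (m : Multigraph V) : Cls :=
  Quotient.mk isoSetoid ⟨Fintype.card V, m.relabel (Fintype.equivFin V)⟩

/-- The working form of isomorphism: it allows arbitrary finite vertex types, such as supports of
components and disjoint unions, and speaks only of multiplicities. -/
theorem cls_eq_iff {V W : Type} [Fintype V] [Fintype W] (m : Multigraph V) (m' : Multigraph W) :
    cls m = cls m' ↔ ∃ σ : V ≃ W, ∀ u v, m'.mul (σ u) (σ v) = m.mul u v := by
  rw [cls, cls, Quotient.eq]
  constructor
  · rintro ⟨σ, h⟩
    rw [relabel_eq_iff] at h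
    refine ⟨(Fintype.equivFin V).trans (σ.trans (Fintype.equivFin W).symm), fun u v => ?_⟩
    have := h (Fintype.equivFin V u) (Fintype.equivFin V v)
    rw [mul_relabel, mul_relabel'] at this
    exact this
  · rintro ⟨σ, h⟩
    refine ⟨(Fintype.equivFin V).symm.trans (σ.trans (Fintype.equivFin W)), ?_⟩
    rw [relabel_eq_iff]
    intro u v
    simp only [Equiv.trans_apply]
    rw [mul_relabel, h, mul_relabel']

theorem cls_fin (g : Σ N : ℕ, Multigraph (Fin N)) : cls g.2 = Quotient.mk isoSetoid g := by
  rw [cls, Quotient.eq]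
  refine ⟨(Fintype.equivFin (Fin g.1)).symm, ?_⟩
  rw [relabel_eq_iff]
  intro u v
  rw [mul_relabel']

theorem cls_relabel {V W : Type} [Fintype V] [Fintype W] (σ : V ≃ W) (m : Multigraph V) :
    cls (m.relabel σ) = cls m :=
  ((cls_eq_iff _ _).2 ⟨σ, mul_relabel σ m⟩).symm

theorem exists_rep (x : Cls) : ∃ (N : ℕ) (m : Multigraph (Fin N)), cls m = x := by
  induction x using Quotient.inductionOn with
  | h g => exact ⟨g.1, g.2, cls_fin g⟩

/-- The number of vertices. -/
def nv : Cls → ℕ := Quotient.lift (fun g => g.1) (by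
  rintro g g' ⟨σ, -⟩
  simpa using Fintype.card_congr σ)

/-- The number of edges. -/
def ne : Cls → ℕ := Quotient.lift (fun g => g.2.degree) (by
  rintro g g' ⟨σ, h⟩
  rw [← h, degree_relabel])

/-- Simplicity of an unlabelled multigraph. -/
def Simple : Cls → Prop := Quotient.lift (fun g => g.2.IsSimple) (by
  rintro g g' ⟨σ, h⟩
  rw [← h, isSimple_relabel])

/-- Connectedness of an unlabelled multigraph. -/
def Conn (x : Cls) : Prop :=
  ∃ (N : ℕ) (m : Multigraph (Fin N)), cls m = x ∧ m.underlying.Connected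

section
variable {V W : Type} [Fintype V] [Fintype W]

theorem nv_cls (m : Multigraph V) : nv (cls m) = Fintype.card V := rfl

theorem ne_cls (m : Multigraph V) : ne (cls m) = m.degree := degree_relabel _ m

theorem simple_cls (m : Multigraph V) : Simple (cls m) ↔ m.IsSimple := isSimple_relabel _ m

/-- Isomorphism of underlying graphs induced by an isomorphism of multigraphs. -/
def underlyingIso {m : Multigraph V} {m' : Multigraph W} (σ : V ≃ W)
    (h : ∀ u v, m'.mul (σ u) (σ v) = m.mul u v) : m.underlying ≃g m'.underlying where
  toEquiv := σ
  map_rel_iff' := by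
    intro u v
    rw [underlying_adj, underlying_adj]
    exact not_congr (by rw [h])

theorem conn_cls (m : Multigraph V) : Conn (cls m) ↔ m.underlying.Connected := by
  constructor
  · rintro ⟨N, m', h, hc⟩
    obtain ⟨σ, hσ⟩ := (cls_eq_iff _ _).1 h
    exact (underlyingIso σ hσ).connected_iff.1 hc
  · intro hc
    refine ⟨_, m.relabel (Fintype.equivFin V), cls_relabel _ _, ?_⟩
    exact (underlyingIso _ (mul_relabel (Fintype.equivFin V) m)).connected_iff.1 hc

open Classical in
/-- The multiset of the classes of the connected components. -/
def comps (m : Multigraph V) : Multiset Cls :=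
  (Finset.univ : Finset m.underlying.ConnectedComponent).val.map fun c => cls (m.restrict c.supp)

-- Any labelling of the vertices whose fibres are the components may replace the quotient by
-- reachability. This makes components computable after a relabelling or in a disjoint union.
open Classical in
theorem comps_eq_of_fibers {ι : Type} [Fintype ι] (m : Multigraph V) (π : V → ι)
    (hs : Function.Surjective π) (hπ : ∀ u v, m.underlying.Reachable u v ↔ π u = π v) :
    comps m = (Finset.univ : Finset ι).val.map fun i => cls (m.restrict {v | π v = i}) := by
  let f : m.underlying.ConnectedComponent → ι :=
    Quot.lift π fun u v h => (hπ u v).1 h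
  have hf : Function.Bijective f := by
    constructor
    · intro a b
      induction a using Quot.inductionOn
      induction b using Quot.inductionOn
      intro h
      exact Quot.sound ((hπ _ _).2 h)
    · intro i
      obtain ⟨v, rfl⟩ := hs i
      exact ⟨Quot.mk _ v, rfl⟩
  have hsupp : ∀ c, c.supp = {v | π v = f c} := by
    refine SimpleGraph.ConnectedComponent.ind fun u => ?_
    ext v
    rw [SimpleGraph.ConnectedComponent.mem_supp_iff, SimpleGraph.ConnectedComponent.eq, hπ]
    rfl
  have h := Finset.map_univ_equiv (Equiv.ofBijective f hf)
  rw [comps, ← h, Finset.map_val, Multiset.map_map]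
  refine Multiset.map_congr rfl fun c _ => ?_
  refine (cls_eq_iff _ _).2 ⟨Equiv.setCongr (hsupp c), fun u v => ?_⟩
  rw [mul_restrict, mul_restrict]
  rfl

end

/-! ### Counting multisets by total weight -/

section MultisetCount

variable {Y A : Type*} [AddCancelCommMonoid A]

/-- The multisets of elements of `S` of total weight `a`. -/
def msSet (S : Set Y) (w : Y → A) (a : A) : Set (Multiset Y) :=
  {μ | (∀ x ∈ μ, x ∈ S) ∧ (μ.map w).sum = a}

variable {S : Finset Y} {w : Y → A} (L : A →+ ℕ)

/-- Every element contributes at least 1 to the `L`-weight; this positivity is what makes the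
multisets of given weight finite in number. -/
theorem card_le_of_mem_msSet {S : Set Y} (hL : ∀ x ∈ S, 0 < L (w x)) {a : A} {μ : Multiset Y}
    (hμ : μ ∈ msSet S w a) : μ.card ≤ L a := by
  rw [← hμ.2, map_multiset_sum, Multiset.map_map]
  have : (μ.map fun _ => 1).sum ≤ (μ.map (L ∘ w)).sum :=
    Multiset.sum_map_le_sum_map _ _ fun x hx => hL x (hμ.1 x hx)
  simpa using this

theorem finite_msSet (hL : ∀ x ∈ S, 0 < L (w x)) (a : A) : (msSet (S : Set Y) w a).Finite := by
  classical
  refine (Multiset.powerset (L a • S.val)).toFinset.finite_toSet.subset fun μ hμ => ?_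
  simp only [Multiset.mem_toFinset, Multiset.mem_powerset, Finset.mem_coe]
  rw [Multiset.le_iff_count]
  intro x
  by_cases hx : x ∈ μ
  · rw [Multiset.count_nsmul, Multiset.count_eq_one_of_mem S.nodup (hμ.1 x hx), mul_one]
    exact (Multiset.count_le_card x μ).trans (card_le_of_mem_msSet L hL hμ)
  · simp [Multiset.count_eq_zero_of_notMem hx]

variable [DecidableEq Y]

/-- Adding or removing `j` copies of `x` is a bijection with the multisets of the complementary
weight. -/
theorem ncard_msSet_filter {x : Y} (hx : x ∈ S) (a c : A) (j : ℕ) (h : j • w x + c = a) :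
    {μ ∈ msSet (S : Set Y) w a | j ≤ μ.count x}.ncard = (msSet (S : Set Y) w c).ncard := by
  symm
  refine Set.ncard_congr (fun μ _ => μ + Multiset.replicate j x) ?_ ?_ ?_
  · rintro μ ⟨h1, h2⟩
    refine ⟨⟨fun y hy => ?_, ?_⟩, ?_⟩
    · rcases Multiset.mem_add.1 hy with hy | hy
      · exact h1 y hy
      · rw [Multiset.eq_of_mem_replicate hy]; exact hx
    · simp [h2, ← h, add_comm]
    · simp
  · intro μ ν _ _ h
    exact add_right_cancel h
  · rintro μ ⟨⟨h1, h2⟩, h3⟩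
    have hle : Multiset.replicate j x ≤ μ := Multiset.le_count_iff_replicate_le.1 h3
    refine ⟨μ - Multiset.replicate j x, ⟨fun y hy => h1 y (Multiset.mem_of_le (Multiset.sub_le_self _ _) hy), ?_⟩,
      tsub_add_cancel_of_le hle⟩
    rw [← tsub_add_cancel_of_le hle] at h2
    rw [Multiset.map_add, Multiset.sum_add, ← h, add_comm] at h2
    simpa using h2

/-- The power sums entering the logarithmic derivative of the generating function. -/
def logCoeff [DecidableEq A] (S : Finset Y) (w : Y → A) (b : A) : ℕ :=
  ∑ x ∈ S, L (w x) * ((Finset.Icc 1 (L b)).filter fun j => j • w x = b).card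

/-- The logarithmic derivative of the Euler product `∏ (1 - t^(w x))⁻¹`, with `L` as the derivation.
Counting the total `L`-weight of all multisets of weight `a` gives the left side; each multiset
contributes `L (w x)` once for every `x` and every `j` from 1 to the multiplicity of `x`, and the
multisets containing `x` at least `j` times correspond to those of weight `a - j • w x`. Grouping by
`b = j • w x` gives the right side. It is applied to orbits of a permutation, to components weighted
by vertices and edges, and to components weighted by edges alone. -/
theorem mul_ncard_msSet [DecidableEq A] [Finset.HasAntidiagonal A]
    (hL : ∀ x ∈ S, 0 < L (w x)) (a : A) :
    L a * (msSet (S : Set Y) w a).ncard =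
      ∑ p ∈ Finset.HasAntidiagonal.antidiagonal a, logCoeff L S w p.1 * (msSet (S : Set Y) w p.2).ncard := by
  set N := fun c => (msSet (S : Set Y) w c).ncard
  set F := (finite_msSet L hL a).toFinset with hF
  have hN : N a = F.card := Set.ncard_eq_toFinset_card _ _
  have h1 : L a * N a = ∑ x ∈ S, L (w x) * ∑ j ∈ Finset.Icc 1 (L a),
      (F.filter fun μ => j ≤ μ.count x).card := by
    rw [hN, Nat.mul_comm, ← smul_eq_mul, ← Finset.sum_const]
    calc ∑ μ ∈ F, L a = ∑ μ ∈ F, ∑ x ∈ S, L (w x) * μ.count x := by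
          refine Finset.sum_congr rfl fun μ hμ => ?_
          have hμ' : μ ∈ msSet (S : Set Y) w a := by simpa [hF] using hμ
          rw [← hμ'.2, map_multiset_sum, Multiset.map_map, Finset.sum_multiset_map_count]
          rw [Finset.sum_subset (s₁ := μ.toFinset) (s₂ := S)]
          · exact Finset.sum_congr rfl fun x _ => by simp [Nat.mul_comm]
          · intro x hx
            exact hμ'.1 x (Multiset.mem_toFinset.1 hx)
          · intro x _ hx
            simp [Multiset.count_eq_zero_of_notMem (fun h => hx (Multiset.mem_toFinset.2 h))]
      _ = ∑ μ ∈ F, ∑ x ∈ S, L (w x) * ∑ j ∈ Finset.Icc 1 (L a), if j ≤ μ.count x then 1 else 0 := by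
          refine Finset.sum_congr rfl fun μ hμ => Finset.sum_congr rfl fun x _ => ?_
          have hμ' : μ ∈ msSet (S : Set Y) w a := by simpa [hF] using hμ
          congr 1
          have hle := (Multiset.count_le_card x μ).trans (card_le_of_mem_msSet L hL hμ')
          rw [← Finset.card_filter]
          have : (Finset.Icc 1 (L a)).filter (fun j => j ≤ μ.count x) = Finset.Icc 1 (μ.count x) := by
            ext j
            simp only [Finset.mem_filter, Finset.mem_Icc]
            omega
          rw [this, Nat.card_Icc]
          omega
      _ = _ := by
          rw [Finset.sum_comm]
          refine Finset.sum_congr rfl fun x _ => ?_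
          rw [← Finset.mul_sum, Finset.sum_comm]
          simp_rw [Finset.card_filter]
  -- The range of `j` may be enlarged from `L b` to `L a`, uniformly in `b`: `j • w x = b` with `L
  -- (w x) > 0` already forces `j ≤ L b`.
  have h2 : ∀ p ∈ Finset.HasAntidiagonal.antidiagonal a, logCoeff L S w p.1 =
      ∑ x ∈ S, L (w x) * ∑ j ∈ Finset.Icc 1 (L a), if j • w x = p.1 then 1 else 0 := by
    intro p hp
    have hp' := Finset.HasAntidiagonal.mem_antidiagonal.1 hp
    refine Finset.sum_congr rfl fun x hx => ?_
    rw [← Finset.card_filter]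
    congr 2
    ext j
    simp only [Finset.mem_filter, Finset.mem_Icc]
    constructor
    · rintro ⟨⟨h1, h2⟩, h3⟩
      refine ⟨⟨h1, h2.trans ?_⟩, h3⟩
      rw [← hp', map_add]
      exact Nat.le_add_right _ _
    · rintro ⟨⟨h1, h2⟩, h3⟩
      refine ⟨⟨h1, ?_⟩, h3⟩
      rw [← h3, map_nsmul, smul_eq_mul]
      exact Nat.le_mul_of_pos_right _ (hL x hx)
  change L a * N a = ∑ p ∈ Finset.HasAntidiagonal.antidiagonal a, logCoeff L S w p.1 * N p.2
  rw [h1]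
  refine Eq.trans ?_ (Finset.sum_congr rfl fun p hp => congrArg (· * N p.2) (h2 p hp)).symm
  simp only [Finset.sum_mul]
  rw [Finset.sum_comm]
  refine Finset.sum_congr rfl fun x hx => ?_
  simp_rw [mul_assoc, ← Finset.mul_sum, Finset.sum_mul]
  rw [Finset.sum_comm]
  congr 1
  refine Finset.sum_congr rfl fun j _ => ?_
  have hcard : (F.filter fun μ => j ≤ μ.count x).card =
      {μ ∈ msSet (S : Set Y) w a | j ≤ μ.count x}.ncard := by
    rw [← Set.ncard_coe_finset]
    congr 1
    ext μ
    simp [hF]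
  rw [hcard]
  -- Either `j • w x` is a summand of `a`, and then cancellation makes the complement unique, or
  -- both sides vanish.
  by_cases hc : ∃ c, j • w x + c = a
  · obtain ⟨c, hc⟩ := hc
    rw [ncard_msSet_filter hx a c j hc, Finset.sum_eq_single (j • w x, c)]
    · simp [N]
    · rintro ⟨b, c'⟩ hb hne
      have hb := Finset.HasAntidiagonal.mem_antidiagonal.1 hb
      have : j • w x ≠ b := by
        rintro rfl
        exact hne (Prod.ext rfl (add_left_cancel (hb.trans hc.symm)))
      simp [this]
    · intro h
      exact absurd (Finset.HasAntidiagonal.mem_antidiagonal.2 hc) h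
  · rw [Finset.sum_eq_zero]
    · rw [Set.ncard_eq_zero ((finite_msSet L hL a).subset fun μ h => h.1)]
      rw [Set.eq_empty_iff_forall_notMem]
      rintro μ ⟨⟨h1, h2⟩, h3⟩
      have hle : Multiset.replicate j x ≤ μ := Multiset.le_count_iff_replicate_le.1 h3
      refine hc ⟨((μ - Multiset.replicate j x).map w).sum, ?_⟩
      rw [← tsub_add_cancel_of_le hle] at h2
      rw [Multiset.map_add, Multiset.sum_add, add_comm] at h2
      simpa using h2
    · rintro ⟨b, c'⟩ hb
      have hb := Finset.HasAntidiagonal.mem_antidiagonal.1 hb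
      have : j • w x ≠ b := by
        rintro rfl
        exact hc ⟨c', hb⟩
      simp [this]

omit [DecidableEq Y] in
theorem ncard_msSet_zero {S : Set Y} (hL : ∀ x ∈ S, 0 < L (w x)) : (msSet S w 0).ncard = 1 := by
  rw [Set.ncard_eq_one]
  refine ⟨0, Set.eq_singleton_iff_unique_mem.2 ⟨⟨by simp, by simp⟩, fun μ hμ => ?_⟩⟩
  have := card_le_of_mem_msSet L hL hμ
  rw [map_zero] at this
  exact Multiset.card_eq_zero.1 (Nat.le_zero.1 this)

end MultisetCount

/-! ### Unlabelled multigraphs as multisets of connected ones -/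

/-- Equality of multisets says that the fibres over each value have the same size; bijections
between the fibres are glued. -/
theorem exists_equiv_of_map_univ_eq {ι κ α : Type*} [Fintype ι] [Fintype κ] {f : ι → α} {g : κ → α}
    (h : (Finset.univ : Finset ι).val.map f = (Finset.univ : Finset κ).val.map g) :
    ∃ e : ι ≃ κ, ∀ i, g (e i) = f i := by
  classical
  have hc : ∀ x, Fintype.card {i // f i = x} = Fintype.card {i // g i = x} := by
    intro x
    have := congrArg (Multiset.count x) h
    rw [Multiset.count_map, Multiset.count_map] at this
    rw [Fintype.card_subtype, Fintype.card_subtype, Finset.card_def, Finset.card_def,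
      Finset.filter_val, Finset.filter_val]
    simpa only [eq_comm] using this
  refine ⟨(Equiv.sigmaFiberEquiv f).symm.trans ((Equiv.sigmaCongrRight fun x =>
    Fintype.equivOfCardEq (hc x)).trans (Equiv.sigmaFiberEquiv g)), fun i => ?_⟩
  exact ((Fintype.equivOfCardEq (hc (f i))) ⟨i, rfl⟩).2

section
variable {V W : Type} [Fintype V] [Fintype W]

omit [Fintype V] in
theorem mul_eq_zero_of_not_reachable {m : Multigraph V} {u v : V}
    (h : ¬ m.underlying.Reachable u v) : m.mul u v = 0 := by
  by_contra h0
  exact h ((underlying_adj m u v).2 h0).reachable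

theorem comps_congr {m : Multigraph V} {m' : Multigraph W} (h : cls m = cls m') :
    comps m = comps m' := by
  classical
  obtain ⟨σ, hσ⟩ := (cls_eq_iff _ _).1 h
  rw [comps_eq_of_fibers m' (fun w => m.underlying.connectedComponentMk (σ.symm w)), comps]
  · refine Multiset.map_congr rfl fun c _ => (cls_eq_iff _ _).2 ⟨⟨fun v => ⟨σ v, ?_⟩, fun w => ⟨σ.symm w, ?_⟩, ?_, ?_⟩, ?_⟩
    · change m.underlying.connectedComponentMk (σ.symm (σ v)) = c
      rw [Equiv.symm_apply_apply]
      exact v.2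
    · exact w.2
    · intro v; simp
    · intro v; simp
    · intro u v
      rw [mul_restrict, mul_restrict]
      exact hσ _ _
  · intro c
    induction c using SimpleGraph.ConnectedComponent.ind with
    | _ v => exact ⟨σ v, by simp⟩
  · intro u v
    rw [SimpleGraph.ConnectedComponent.eq, ← (underlyingIso σ hσ).reachable_iff]
    simp [underlyingIso]

/-- Components of equal class are matched and the chosen isomorphisms glued. Nothing has to be
checked between different components, where all multiplicities are zero on both sides. -/
theorem cls_eq_of_comps_eq {m : Multigraph V} {m' : Multigraph W} (h : comps m = comps m') :
    cls m = cls m' := by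
  classical
  obtain ⟨e, he⟩ := exists_equiv_of_map_univ_eq h
  choose τ hτ using fun c => (cls_eq_iff _ _).1 (he c).symm
  let σ : V ≃ W := (Equiv.sigmaFiberEquiv m.underlying.connectedComponentMk).symm.trans
    ((Equiv.sigmaCongr e fun c => τ c).trans (Equiv.sigmaFiberEquiv m'.underlying.connectedComponentMk))
  have hσ : ∀ c (v : c.supp), σ v = τ c v := by
    rintro c ⟨v, rfl⟩
    rfl
  have hmk : ∀ v, m'.underlying.connectedComponentMk (σ v) = e (m.underlying.connectedComponentMk v) := by
    intro v
    rw [hσ (m.underlying.connectedComponentMk v) ⟨v, rfl⟩]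
    exact (τ _ _).2
  refine (cls_eq_iff _ _).2 ⟨σ, fun u v => ?_⟩
  by_cases huv : m.underlying.Reachable u v
  · have hu : u ∈ (m.underlying.connectedComponentMk v).supp := by
      simpa using huv
    have := hτ _ ⟨u, hu⟩ ⟨v, rfl⟩
    rwa [mul_restrict, mul_restrict, ← hσ, ← hσ] at this
  · rw [mul_eq_zero_of_not_reachable huv]
    apply mul_eq_zero_of_not_reachable
    rw [← SimpleGraph.ConnectedComponent.eq, hmk, hmk, e.injective.eq_iff]
    simpa using huv

theorem underlying_restrict (m : Multigraph V) (S : Set V) [Fintype S] :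
    (m.restrict S).underlying = m.underlying.induce S := by
  ext a b
  rw [underlying_adj, mul_restrict, SimpleGraph.comap_adj, underlying_adj]
  rfl

theorem conn_of_mem_comps {m : Multigraph V} {x : Cls} (h : x ∈ comps m) : Conn x := by
  classical
  obtain ⟨c, -, rfl⟩ := Multiset.mem_map.1 h
  rw [conn_cls, underlying_restrict]
  exact c.connected_toSimpleGraph

theorem sum_fiber {ι M : Type*} [AddCommMonoid M] [Fintype ι] (f : V → M) (π : V → ι)
    [∀ i, Fintype {v // π v = i}] :
    ∑ v, f v = ∑ i, ∑ v : {v // π v = i}, f v := by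
  rw [← (Equiv.sigmaFiberEquiv π).sum_comp, Fintype.sum_sigma]
  rfl

open Classical in
theorem sum_supp {M : Type*} [AddCommMonoid M] (m : Multigraph V) (f : V → M)
    [∀ c : m.underlying.ConnectedComponent, Fintype c.supp] :
    ∑ v, f v = ∑ c : m.underlying.ConnectedComponent, ∑ v : c.supp, f v := by
  rw [sum_fiber f m.underlying.connectedComponentMk]
  refine Fintype.sum_congr _ _ fun c => ?_
  convert rfl
  · exact Iff.rfl
  · rfl

theorem sum_nv_comps (m : Multigraph V) : ((comps m).map nv).sum = Fintype.card V := by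
  classical
  rw [comps, Multiset.map_map, Fintype.card_eq_sum_ones,
    sum_supp m]
  refine Finset.sum_congr rfl fun c _ => ?_
  rw [Function.comp_apply, nv_cls, Fintype.card_eq_sum_ones]

theorem sum_ne_comps (m : Multigraph V) : ((comps m).map ne).sum = m.degree := by
  classical
  have h : 2 * ((comps m).map ne).sum = 2 * m.degree := by
    rw [two_mul_degree, comps, Multiset.map_map, ← Multiset.sum_map_mul_left,
      sum_supp m]
    refine Finset.sum_congr rfl fun c _ => ?_
    rw [Function.comp_apply, ne_cls, two_mul_degree]
    refine Finset.sum_congr rfl fun u _ => ?_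
    rw [sum_supp m, Finset.sum_eq_single c]
    · refine Finset.sum_congr rfl fun v _ => ?_
      exact mul_restrict m c.supp u v
    · intro d _ hd
      refine Finset.sum_eq_zero fun v _ => ?_
      apply mul_eq_zero_of_not_reachable
      rw [← SimpleGraph.ConnectedComponent.eq]
      intro h
      exact hd (v.2.symm.trans (h.symm.trans u.2))
    · simp
  omega

theorem simple_comps (m : Multigraph V) : (∀ x ∈ comps m, Simple x) ↔ m.IsSimple := by
  classical
  rw [isSimple_iff]
  constructor
  · intro h u v
    by_cases huv : m.underlying.Reachable u v
    · have hu : u ∈ (m.underlying.connectedComponentMk v).supp := by simpa using huv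
      have := h _ (Multiset.mem_map.2 ⟨m.underlying.connectedComponentMk v, by simp, rfl⟩)
      rw [simple_cls, isSimple_iff] at this
      have := this ⟨u, hu⟩ ⟨v, rfl⟩
      rwa [mul_restrict] at this
    · simp [mul_eq_zero_of_not_reachable huv]
  · intro h x hx
    obtain ⟨c, -, rfl⟩ := Multiset.mem_map.1 hx
    rw [simple_cls, isSimple_iff]
    intro u v
    rw [mul_restrict]
    exact h _ _

end

/-- The disjoint union of representatives, built on a sigma type. Together with `cls_eq_of_comps_eq`
this identifies unlabelled multigraphs with multisets of connected ones. -/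
theorem exists_comps_eq (μ : Multiset Cls) (h : ∀ x ∈ μ, Conn x) :
    ∃ (N : ℕ) (m : Multigraph (Fin N)), comps m = μ := by
  classical
  have h' : ∀ i : Fin μ.toList.length, ∃ (N : ℕ) (m : Multigraph (Fin N)),
      cls m = μ.toList.get i ∧ m.underlying.Connected := by
    intro i
    exact h _ (Multiset.mem_toList.1 (List.get_mem _ _))
  choose N m hm hc using h'
  let V := Σ i, Fin (N i)
  let f : V → V → ℕ := fun a b => if h : a.1 = b.1 then (m b.1).mul (h ▸ a.2) b.2 else 0
  have hf : ∀ i (a b : Fin (N i)), f ⟨i, a⟩ ⟨i, b⟩ = (m i).mul a b := by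
    intro i a b
    simp [f]
  have hf' : ∀ a b : V, a.1 ≠ b.1 → f a b = 0 := by
    intro a b hab
    simp [f, hab]
  have hsymm : ∀ a b, f a b = f b a := by
    rintro ⟨i, a⟩ ⟨j, b⟩
    by_cases hij : i = j
    · subst hij
      rw [hf, hf, Multigraph.mul_comm]
    · rw [hf' _ _ hij, hf' _ _ (Ne.symm hij)]
  have h0 : ∀ a, f a a = 0 := by
    rintro ⟨i, a⟩
    rw [hf, mul_self]
  let M : Multigraph V := ofMul f hsymm
  have hM : ∀ a b, M.mul a b = f a b := mul_ofMul f hsymm h0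
  have hadj : ∀ i, ∀ a b, (m i).underlying.Reachable a b → M.underlying.Reachable ⟨i, a⟩ ⟨i, b⟩ := by
    intro i a b hab
    refine SimpleGraph.Reachable.map (G := (m i).underlying) (⟨fun a => (⟨i, a⟩ : V), fun {a b} hab => ?_⟩ : (m i).underlying →g M.underlying) hab
    rw [underlying_adj] at hab ⊢
    rwa [hM, hf]
  have hreach : ∀ u v : V, M.underlying.Reachable u v ↔ u.1 = v.1 := by
    intro u v
    constructor
    · rintro ⟨p⟩
      induction p with
      | nil => rfl
      | cons hadj _ ih =>
        refine Eq.trans ?_ ih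
        by_contra hne
        rw [underlying_adj, hM, hf' _ _ hne] at hadj
        exact hadj rfl
    · obtain ⟨i, a⟩ := u
      obtain ⟨j, b⟩ := v
      rintro (rfl : i = j)
      exact hadj i a b ((hc i).preconnected a b)
  have hcomps : comps M = μ := by
    have hμ : Finset.univ.val.map μ.toList.get = μ := by
      conv_rhs => rw [← Multiset.coe_toList μ, ← List.ofFn_get μ.toList, List.ofFn_eq_map,
        ← Multiset.map_coe]
      rfl
    rw [comps_eq_of_fibers M Sigma.fst ?_ hreach]
    · refine (Multiset.map_congr rfl fun i _ => ?_).trans hμ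
      rw [← hm i]
      suffices hi : cls (M.restrict {v | v.1 = i}) = cls (m i) by convert hi
      refine (cls_eq_iff _ _).2 ⟨⟨fun a => a.2 ▸ a.1.2, fun b => ⟨⟨i, b⟩, rfl⟩, ?_, fun b => rfl⟩, ?_⟩
      · rintro ⟨⟨j, a⟩, (rfl : j = i)⟩
        rfl
      · rintro ⟨⟨j, a⟩, (rfl : j = i)⟩ ⟨⟨k, b⟩, (rfl : k = j)⟩
        rw [mul_restrict, hM, hf]
        rfl
    · intro i
      obtain ⟨v⟩ := (hc i).nonempty
      exact ⟨⟨i, v⟩, rfl⟩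
  exact ⟨_, M.relabel (Fintype.equivFin V), by rw [comps_congr (cls_relabel _ M), hcomps]⟩

/-- The multiset of the connected components of an unlabelled multigraph. -/
def components (x : Cls) : Multiset Cls := comps x.out.2

theorem components_cls {V : Type} [Fintype V] (m : Multigraph V) : components (cls m) = comps m := by
  apply comps_congr
  rw [cls_fin, Quotient.out_eq]

theorem components_injective : Function.Injective components := by
  intro x y h
  obtain ⟨_, m, rfl⟩ := exists_rep x
  obtain ⟨_, m', rfl⟩ := exists_rep y
  rw [components_cls, components_cls] at h
  exact cls_eq_of_comps_eq h

theorem conn_of_mem_components {x y : Cls} (h : y ∈ components x) : Conn y := conn_of_mem_comps h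

theorem exists_components_eq (μ : Multiset Cls) (h : ∀ x ∈ μ, Conn x) : ∃ x, components x = μ := by
  obtain ⟨N, m, rfl⟩ := exists_comps_eq μ h
  exact ⟨cls m, components_cls m⟩

theorem sum_nv_components (x : Cls) : ((components x).map nv).sum = nv x := by
  obtain ⟨_, m, rfl⟩ := exists_rep x
  rw [components_cls, sum_nv_comps, nv_cls]

theorem sum_ne_components (x : Cls) : ((components x).map ne).sum = ne x := by
  obtain ⟨_, m, rfl⟩ := exists_rep x
  rw [components_cls, sum_ne_comps, ne_cls]

theorem simple_components (x : Cls) : (∀ y ∈ components x, Simple y) ↔ Simple x := by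
  obtain ⟨_, m, rfl⟩ := exists_rep x
  rw [components_cls, simple_comps, simple_cls]

theorem Conn.nv_pos {x : Cls} (h : Conn x) : 0 < nv x := by
  obtain ⟨N, m, rfl, hc⟩ := h
  rw [nv_cls]
  obtain ⟨v⟩ := hc.nonempty
  exact Fintype.card_pos_iff.2 ⟨v⟩

/-- Without edges, connectedness leaves a single vertex. Away from that class the number of edges is
therefore a positive weight, as the counting of multisets requires. -/
theorem Conn.ne_pos {x : Cls} (h : Conn x) (h2 : nv x ≠ 1) : 0 < ne x := by
  obtain ⟨N, m, rfl, hc⟩ := h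
  rw [nv_cls] at h2
  rw [ne_cls, Nat.pos_iff_ne_zero]
  intro h0
  rw [Finsupp.degree_eq_zero_iff] at h0
  obtain ⟨v⟩ := hc.nonempty
  have : Subsingleton (Fin N) := by
    refine ⟨fun a b => ?_⟩
    obtain ⟨p⟩ := hc.preconnected a b
    cases p with
    | nil => rfl
    | cons hadj _ => simp [underlying_adj, h0, Multigraph.mul_zero] at hadj
  exact h2 (Fintype.card_eq_one_iff.2 ⟨v, fun a => Subsingleton.elim _ _⟩)

/-! ### Functions fixed by a permutation -/

/-- The `k`-th power of a `p`-cycle is trivial if `p ∣ k` and otherwise still moves every point of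
the cycle; the supports of disjoint cycles add up. -/
theorem card_support_pow {α : Type*} [Fintype α] [DecidableEq α] (σ : Equiv.Perm α) (k : ℕ) :
    (σ ^ k).support.card = (σ.cycleType.map fun p => if k % p = 0 then 0 else p).sum := by
  induction σ using Equiv.Perm.cycle_induction_on with
  | base_one => simp
  | base_cycles σ hσ =>
    rw [hσ.cycleType, Multiset.map_singleton, Multiset.sum_singleton, ← hσ.orderOf]
    split_ifs with h
    · rw [orderOf_dvd_iff_pow_eq_one.1 (Nat.dvd_of_mod_eq_zero h)]
      simp
    · rw [hσ.support_pow_eq_iff.2 fun h' => h (Nat.mod_eq_zero_of_dvd h'), hσ.orderOf]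
  | induction_disjoint σ τ hd _ hσ hτ =>
    rw [hd.commute.mul_pow, (hd.pow_disjoint_pow k k).card_support_mul, hσ, hτ, hd.cycleType_mul,
      Multiset.map_add, Multiset.sum_add]

/-- The number of fixed points. -/
def fixCount {X : Type*} (π : Equiv.Perm X) : ℕ := {x | π x = x}.ncard

theorem fixCount_pow {α : Type*} [Fintype α] [DecidableEq α] (σ : Equiv.Perm α) (k : ℕ) :
    fixCount (σ ^ k) =
      Fintype.card α - (σ.cycleType.map fun p => if k % p = 0 then 0 else p).sum := by
  rw [← card_support_pow, ← Finset.card_compl, fixCount, ← Set.ncard_coe_finset]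
  congr 1
  ext x
  simp

section Fixed

variable {X : Type*} [Fintype X] (π : Equiv.Perm X)

/-- The functions of total sum `d` fixed by `π`. -/
def fixedFun (d : ℕ) : Set (X →₀ ℕ) := {m | (∀ x, m (π x) = m x) ∧ m.degree = d}

/-- The functions with values in `{0, 1}` of total sum `d` fixed by `π`. -/
def fixedSimple (d : ℕ) : Set (X →₀ ℕ) :=
  {m | (∀ x, m (π x) = m x) ∧ (∀ x, m x ≤ 1) ∧ m.degree = d}

theorem finite_degree_eq (d : ℕ) : {m : X →₀ ℕ | m.degree = d}.Finite := by
  classical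
  refine ((Finset.univ : Finset X).finsuppAntidiag d).finite_toSet.subset fun m hm => ?_
  simp only [Finset.mem_coe, Finset.mem_finsuppAntidiag]
  exact ⟨by rw [← hm, Finsupp.degree_eq_sum], Finset.subset_univ _⟩

/-- The orbits of a permutation. -/
abbrev Orb : Type _ := MulAction.orbitRel.Quotient (Subgroup.zpowers π) X

open Classical in
instance : Fintype (Orb π) := Quotient.fintype _

/-- The orbit of a point. -/
abbrev orbMk (x : X) : Orb π := Quotient.mk'' x

open Classical in
/-- The size of an orbit. -/
def orbSize (q : Orb π) : ℕ := Fintype.card {x // orbMk π x = q}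

omit [Fintype X] in
theorem orbMk_apply (x : X) : orbMk π (π x) = orbMk π x := by
  apply Quotient.sound'
  exact ⟨⟨π, Subgroup.mem_zpowers π⟩, rfl⟩

theorem orbSize_dvd_iff (x : X) (k : ℕ) : orbSize π (orbMk π x) ∣ k ↔ (π ^ k) x = x := by
  classical
  have h : orbSize π (orbMk π x) = Function.minimalPeriod (π • ·) x := by
    rw [MulAction.minimalPeriod_eq_card, orbSize]
    refine Fintype.card_congr (Equiv.subtypeEquivRight fun y => ?_)
    rw [Quotient.eq'']
    rfl
  rw [h, ← MulAction.pow_smul_eq_iff_minimalPeriod_dvd]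
  rfl

theorem orbSize_pos (q : Orb π) : 0 < orbSize π q := by
  induction q using Quotient.inductionOn' with
  | h x =>
    classical
    exact Fintype.card_pos_iff.2 ⟨⟨x, rfl⟩⟩

omit [Fintype X] in
theorem eq_of_orbMk_eq {m : X → ℕ} (hm : ∀ x, m (π x) = m x) {x y : X}
    (h : orbMk π x = orbMk π y) : m x = m y := by
  obtain ⟨⟨_, ⟨i, rfl⟩⟩, rfl⟩ := Quotient.exact' h
  change m ((π ^ i) y) = m y
  clear h
  induction i using Int.induction_on with
  | zero => simp
  | succ i ih => rw [add_comm, zpow_one_add, Equiv.Perm.mul_apply, hm]; exact ih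
  | pred i ih =>
    rw [← hm, ← Equiv.Perm.mul_apply, ← zpow_one_add, add_sub_cancel]
    exact ih

theorem sum_orb (f : Orb π → ℕ) : ∑ x, f (orbMk π x) = ∑ q, orbSize π q * f q := by
  classical
  rw [← (Equiv.sigmaFiberEquiv (orbMk π)).sum_comp, Fintype.sum_sigma]
  refine Finset.sum_congr rfl fun q _ => ?_
  rw [Finset.sum_congr rfl (g := fun _ => f q) fun x _ => congrArg f x.2]
  simp [orbSize]

/-- A fixed function is constant on orbits, hence a multiset of orbits, and its sum is the total
size of these orbits. -/
theorem ncard_fixedFun (d : ℕ) :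
    (fixedFun π d).ncard = (msSet ((Finset.univ : Finset (Orb π)) : Set (Orb π)) (orbSize π) d).ncard := by
  classical
  symm
  have hdeg : ∀ μ : Multiset (Orb π), (μ.map (orbSize π)).sum =
      (Finsupp.equivFunOnFinite.symm fun x => μ.count (orbMk π x)).degree := by
    intro μ
    rw [Finsupp.degree_eq_sum]
    simp only [Finsupp.equivFunOnFinite_symm_apply_apply]
    rw [sum_orb π fun q => μ.count q, Finset.sum_multiset_map_count,
      Finset.sum_subset (Finset.subset_univ _)]
    · exact Finset.sum_congr rfl fun q _ => by rw [smul_eq_mul, Nat.mul_comm]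
    · intro q _ hq
      simp [Multiset.count_eq_zero_of_notMem (fun h => hq (Multiset.mem_toFinset.2 h))]
  refine Set.ncard_congr (fun μ _ => Finsupp.equivFunOnFinite.symm fun x => μ.count (orbMk π x)) ?_ ?_ ?_
  · rintro μ ⟨-, hμ⟩
    refine ⟨fun x => ?_, by rw [← hdeg, hμ]⟩
    simp [orbMk_apply]
  · intro μ ν _ _ h
    ext q
    induction q using Quotient.inductionOn' with
    | h x => exact DFunLike.congr_fun h x
  · rintro m ⟨hm, hd⟩
    let f : Orb π → ℕ := fun q => m q.out
    have hf : ∀ x, f (orbMk π x) = m x := fun x => eq_of_orbMk_eq π hm (Quotient.out_eq' _)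
    let μ : Multiset (Orb π) := Finsupp.toMultiset (Finsupp.equivFunOnFinite.symm f)
    have hμ : Finsupp.equivFunOnFinite.symm (fun x => μ.count (orbMk π x)) = m := by
      ext x
      simp [μ, Finsupp.count_toMultiset, hf]
    exact ⟨μ, ⟨by simp, by rw [hdeg, hμ, hd]⟩, hμ⟩

/-- The points fixed by `π ^ k` are those whose orbit size divides `k`, and an orbit of size `s`
dividing `k` contributes its `s` points. -/
theorem logCoeff_orbSize (k : ℕ) (hk : 0 < k) [DecidableEq (Orb π)] :
    logCoeff (AddMonoidHom.id ℕ) Finset.univ (orbSize π) k = fixCount (π ^ k) := by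
  classical
  have h1 : ∀ q : Orb π, ((Finset.Icc 1 k).filter fun j => j • orbSize π q = k).card =
      if orbSize π q ∣ k then 1 else 0 := by
    intro q
    split_ifs with h
    · rw [Finset.card_eq_one]
      refine ⟨k / orbSize π q, ?_⟩
      ext j
      simp only [Finset.mem_filter, Finset.mem_Icc, Finset.mem_singleton, smul_eq_mul]
      obtain ⟨c, rfl⟩ := h
      have := orbSize_pos π q
      rw [Nat.mul_div_cancel_left _ this]
      constructor
      · rintro ⟨-, h⟩
        rw [_root_.mul_comm] at h
        exact Nat.eq_of_mul_eq_mul_left this h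
      · rintro rfl
        refine ⟨⟨Nat.pos_of_mul_pos_left hk, Nat.le_mul_of_pos_left _ this⟩, _root_.mul_comm _ _⟩
    · rw [Finset.card_eq_zero, Finset.filter_eq_empty_iff]
      intro j _ hj
      exact h (Dvd.intro_left j hj)
  unfold logCoeff
  simp only [AddMonoidHom.id_apply, h1]
  rw [← sum_orb π fun q => if orbSize π q ∣ k then 1 else 0]
  simp only [orbSize_dvd_iff]
  rw [← Finset.card_filter, fixCount, ← Set.ncard_coe_finset]
  simp

/-- Newton's identity between complete symmetric functions and power sums: only the fixed point
counts of the powers of `π` are needed. The index is shifted because the term of weight 0 vanishes.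
-/
theorem mul_ncard_fixedFun (d : ℕ) :
    d * (fixedFun π d).ncard =
      ∑ k ∈ Finset.range d, fixCount (π ^ (k + 1)) * (fixedFun π (d - (k + 1))).ncard := by
  classical
  have h := mul_ncard_msSet (S := Finset.univ) (w := orbSize π) (AddMonoidHom.id ℕ)
    (fun q _ => orbSize_pos π q) d
  rw [Finset.Nat.sum_antidiagonal_eq_sum_range_succ
    (fun i j => logCoeff (AddMonoidHom.id ℕ) Finset.univ (orbSize π) i * (msSet _ (orbSize π) j).ncard),
    Finset.sum_range_succ'] at h
  simp only [← ncard_fixedFun] at h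
  have h0 : logCoeff (AddMonoidHom.id ℕ) Finset.univ (orbSize π) 0 = 0 := by
    simp [logCoeff]
  rw [h0, Nat.zero_mul, Nat.add_zero] at h
  refine h.trans (Finset.sum_congr rfl fun k _ => ?_)
  rw [logCoeff_orbSize π (k + 1) k.succ_pos]

theorem ncard_fixedFun_zero : (fixedFun π 0).ncard = 1 := by
  rw [ncard_fixedFun]
  exact ncard_msSet_zero (AddMonoidHom.id ℕ) (fun q _ => orbSize_pos π q)

/-- Halving each value with remainder writes a fixed function uniquely as `2 t + s`, with `t` fixed
and `s` fixed with values in `{0, 1}`. In generating functions: `M(z) = M(z²) S(z)`. -/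
theorem ncard_fixedFun_eq_sum_simple (d : ℕ) :
    (fixedFun π d).ncard =
      ∑ b ∈ Finset.range (d / 2 + 1), (fixedFun π b).ncard * (fixedSimple π (d - 2 * b)).ncard := by
  classical
  have hfin : ∀ d, (fixedFun π d).Finite := fun d => (finite_degree_eq d).subset fun m h => h.2
  let half : (X →₀ ℕ) → (X →₀ ℕ) := fun m => Finsupp.equivFunOnFinite.symm fun x => m x / 2
  have hhalf : ∀ m x, half m x = m x / 2 := fun m x => rfl
  have hle : ∀ m, 2 * (half m).degree ≤ m.degree := by
    intro m
    rw [Finsupp.degree_eq_sum, Finsupp.degree_eq_sum, Finset.mul_sum]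
    exact Finset.sum_le_sum fun x _ => by rw [hhalf]; omega
  rw [Set.ncard_eq_toFinset_card _ (hfin d), Finset.card_eq_sum_card_fiberwise
    (f := fun m => (half m).degree) (t := Finset.range (d / 2 + 1))]
  · refine Finset.sum_congr rfl fun b hb => ?_
    have hb' : 2 * b ≤ d := by
      have := Finset.mem_range.1 hb
      omega
    rw [← Set.ncard_prod, ← Set.ncard_coe_finset]
    symm
    refine Set.ncard_congr (fun p _ => 2 • p.1 + p.2) ?_ ?_ ?_
    · rintro ⟨t, s⟩ ⟨⟨ht, htd⟩, hs, hs1, hsd⟩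
      have hh : half (2 • t + s) = t := by
        ext x
        have := hs1 x
        simp only [hhalf, Finsupp.add_apply, Finsupp.smul_apply, smul_eq_mul]
        dsimp only at this
        omega
      simp only [Finset.coe_filter, Set.Finite.mem_toFinset, Set.mem_ofPred_eq]
      refine ⟨⟨fun x => ?_, ?_⟩, by rw [hh]; exact htd⟩
      · simp only [Finsupp.add_apply, Finsupp.smul_apply]
        rw [ht x, hs x]
      · rw [map_add, map_nsmul, htd, hsd, smul_eq_mul]
        omega
    · rintro ⟨t, s⟩ ⟨t', s'⟩ ⟨-, -, hs1, -⟩ ⟨-, -, hs1', -⟩ h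
      have key : ∀ x, t x = t' x ∧ s x = s' x := by
        intro x
        have h1 := DFunLike.congr_fun h x
        have h2 := hs1 x
        have h3 := hs1' x
        simp only [Finsupp.add_apply, Finsupp.smul_apply, smul_eq_mul] at h1 h2 h3
        omega
      rw [Prod.mk.injEq]
      exact ⟨Finsupp.ext fun x => (key x).1, Finsupp.ext fun x => (key x).2⟩
    · intro m hm
      simp only [Finset.coe_filter, Set.Finite.mem_toFinset, Set.mem_ofPred_eq] at hm
      obtain ⟨⟨hm, hd⟩, hmb⟩ := hm
      let r : X →₀ ℕ := Finsupp.equivFunOnFinite.symm fun x => m x % 2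
      have hr : ∀ x, r x = m x % 2 := fun x => rfl
      have hadd : 2 • half m + r = m := by
        ext x
        simp only [Finsupp.add_apply, Finsupp.smul_apply, smul_eq_mul, hhalf, hr]
        omega
      refine ⟨(half m, r), ⟨⟨fun x => ?_, hmb⟩, fun x => ?_, fun x => ?_, ?_⟩, hadd⟩
      · simp only [hhalf, hm]
      · simp only [hr, hm]
      · simp only [hr]; omega
      · have := congrArg Finsupp.degree hadd
        rw [map_add, map_nsmul, hmb, hd, smul_eq_mul] at this
        dsimp only
        omega
  · intro m hm
    have hm' : m ∈ fixedFun π d := by simpa using hm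
    have := hle m
    rw [hm'.2] at this
    simp only [Finset.coe_range, Set.mem_Iio]
    omega

end Fixed

/-! ### Fixed pairs -/

section Pairs
variable {V : Type*} [Fintype V]

omit [Fintype V] in
theorem pairEquiv_pow (σ : Equiv.Perm V) (k : ℕ) : (pairEquiv σ : Equiv.Perm (Pair V)) ^ k = pairEquiv (σ ^ k) := by
  induction k with
  | zero =>
    ext e
    simp [pairEquiv]
  | succ k ih =>
    ext e
    rw [pow_succ, pow_succ, ih]
    simp [pairEquiv, Sym2.map_map]

/-- A fixed pair consists of two fixed points or is a 2-cycle. With `a` fixed points of `σ` and `b`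
of `σ ^ 2` this gives `a (a - 1) / 2 + (b - a) / 2` pairs, written here without subtraction or
division. -/
theorem two_mul_fixCount_pairEquiv (σ : Equiv.Perm V) :
    2 * fixCount (pairEquiv σ : Equiv.Perm (Pair V)) + 2 * fixCount σ =
      fixCount σ * fixCount σ + fixCount (σ ^ 2) := by
  classical
  -- The indicator of the fixed pairs is viewed as a multigraph, so that `two_mul_degree` applies.
  -- The identity is checked for each ordered pair `(u, v)` and then summed; the two diagonal terms
  -- on the left produce `2 * fixCount σ`.
  let m : Multigraph V := Finsupp.equivFunOnFinite.symm fun e => if pairEquiv σ e = e then 1 else 0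
  have hm : ∀ u v, m.mul u v + (if σ u = u then if u = v then 1 else 0 else 0) +
      (if σ u = u then if u = v then 1 else 0 else 0) =
      (if σ u = u then 1 else 0) * (if σ v = v then 1 else 0) +
        if (σ ^ 2) u = u then if v = σ u then 1 else 0 else 0 := by
    intro u v
    rw [sq, Equiv.Perm.mul_apply]
    by_cases huv : u = v
    · subst huv
      rw [mul_self]
      by_cases h : σ u = u
      · simp [h]
      · simp [h, Ne.symm h]
    · rw [mul_of_ne m (by simpa using huv)]
      have h : m ⟨s(u, v), by simpa using huv⟩ = if (σ u = u ∧ σ v = v) ∨ (σ u = v ∧ σ v = u) then 1 else 0 := by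
        simp [m, pairEquiv, Subtype.ext_iff]
      rw [h]
      by_cases h1 : σ u = u
      · have h2 : σ v ≠ u := fun h => huv (σ.injective (h1.trans h.symm))
        have h3 : σ u ≠ v := fun h => huv (h1.symm.trans h)
        by_cases h4 : σ v = v <;> simp [h1, h4, huv, Ne.symm huv, h2]
      · by_cases h2 : v = σ u
        · subst h2
          by_cases h5 : σ (σ u) = u <;> simp [h1, h5]
        · have h3 : ¬ σ u = v := fun h => h2 h.symm
          simp [h1, h2, h3]
  have hsum := Finset.sum_congr rfl fun u (_ : u ∈ Finset.univ) =>
    Finset.sum_congr rfl fun v (_ : v ∈ Finset.univ) => hm u v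
  simp only [Finset.sum_add_distrib] at hsum
  rw [← two_mul_degree, ← Finset.sum_mul_sum] at hsum
  have hfix : ∀ τ : Equiv.Perm V, fixCount τ = ∑ u, if τ u = u then 1 else 0 := by
    intro τ
    rw [fixCount, ← Finset.card_filter, ← Set.ncard_coe_finset]
    simp
  have hfixp : fixCount (pairEquiv σ : Equiv.Perm (Pair V)) = m.degree := by
    rw [fixCount, Finsupp.degree_eq_sum]
    simp only [m, Finsupp.equivFunOnFinite_symm_apply_apply]
    rw [← Finset.card_filter, ← Set.ncard_coe_finset]
    simp
  have e1 : ∀ u, (∑ v, if σ u = u then if u = v then 1 else 0 else 0) = if σ u = u then 1 else 0 := by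
    intro u
    split_ifs <;> simp
  have e2 : ∀ u, (∑ v, if (σ ^ 2) u = u then if v = σ u then 1 else 0 else 0) = if (σ ^ 2) u = u then 1 else 0 := by
    intro u
    split_ifs <;> simp
  simp only [e1, e2, ← hfix, ← hfixp] at hsum
  omega

end Pairs

/-! ### Burnside's lemma -/

/-- The number of unlabelled multigraphs in `P` with `n` vertices and `d` edges. -/
def classNum (P : Cls → Prop) (n d : ℕ) : ℕ := {x | nv x = n ∧ ne x = d ∧ P x}.ncard

section Burnside

/-- The labelled multigraphs with `n` vertices and `d` edges whose class is in `P`. -/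
def Labelled (P : Cls → Prop) (n d : ℕ) : Type :=
  {m : Multigraph (Fin n) // m.degree = d ∧ P (cls m)}

theorem relabel_relabel {U V W : Type*} (τ : U ≃ V) (σ : V ≃ W) (m : Multigraph U) :
    (m.relabel τ).relabel σ = m.relabel (τ.trans σ) := by
  rw [relabel_eq_iff]
  intro u v
  rw [mul_relabel', mul_relabel']
  simp

theorem relabel_refl {V : Type*} (m : Multigraph V) : m.relabel (Equiv.refl V) = m := by
  rw [relabel_eq_iff]
  intro u v
  rfl

variable (P : Cls → Prop) (n d : ℕ)

instance : MulAction (Equiv.Perm (Fin n)) (Labelled P n d) where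
  smul σ m := ⟨m.1.relabel σ, by rw [degree_relabel, cls_relabel]; exact m.2⟩
  one_smul m := Subtype.ext (relabel_refl m.1)
  mul_smul σ τ m := Subtype.ext (relabel_relabel τ σ m.1).symm

instance : Finite (Labelled P n d) :=
  ((finite_degree_eq d).subset fun _ h => h.1 : {m : Multigraph (Fin n) | m.degree = d ∧ P (cls m)}.Finite)

theorem exists_rep_fin {x : Cls} {n : ℕ} (h : nv x = n) : ∃ m : Multigraph (Fin n), cls m = x := by
  obtain ⟨N, m, rfl⟩ := exists_rep x
  rw [nv_cls, Fintype.card_fin] at h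
  subst h
  exact ⟨m, rfl⟩

theorem card_orbits_labelled :
    Nat.card (MulAction.orbitRel.Quotient (Equiv.Perm (Fin n)) (Labelled P n d)) = classNum P n d := by
  rw [classNum, ← Nat.card_coe_set_eq]
  refine Nat.card_congr (Equiv.ofBijective (Quotient.lift
    (fun m : Labelled P n d => (⟨cls m.1, (nv_cls _).trans (Fintype.card_fin n), (ne_cls _).trans m.2.1, m.2.2⟩ :
      {x | nv x = n ∧ ne x = d ∧ P x})) ?_) ⟨?_, ?_⟩)
  · rintro m m' ⟨σ, rfl⟩
    exact Subtype.ext (cls_relabel σ m'.1)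
  · intro a b
    induction a using Quotient.inductionOn with
    | h a =>
    induction b using Quotient.inductionOn with
    | h b =>
    intro h
    obtain ⟨σ, hσ⟩ := (cls_eq_iff _ _).1 (congrArg Subtype.val h)
    apply Quotient.sound
    refine (MulAction.orbitRel (Equiv.Perm (Fin n)) (Labelled P n d)).symm ?_
    exact ⟨σ, Subtype.ext ((relabel_eq_iff σ a.1 b.1).2 hσ)⟩
  · rintro ⟨x, h1, h2, h3⟩
    obtain ⟨m, rfl⟩ := exists_rep_fin h1
    exact ⟨Quotient.mk _ ⟨m, by rw [← ne_cls]; exact ⟨h2, h3⟩⟩, rfl⟩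

/-- Orbit counting, valid for any `P` since a property of classes is invariant under relabelling. -/
theorem classNum_mul_factorial :
    classNum P n d * n.factorial = ∑ σ : Equiv.Perm (Fin n),
      {m : Multigraph (Fin n) | m.relabel σ = m ∧ m.degree = d ∧ P (cls m)}.ncard := by
  classical
  have : Fintype (Labelled P n d) := Fintype.ofFinite _
  have : Fintype (MulAction.orbitRel.Quotient (Equiv.Perm (Fin n)) (Labelled P n d)) := Fintype.ofFinite _
  have h := MulAction.sum_card_fixedBy_eq_card_orbits_mul_card_group (Equiv.Perm (Fin n)) (Labelled P n d)
  rw [Fintype.card_perm, Fintype.card_fin, ← Nat.card_eq_fintype_card, card_orbits_labelled] at h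
  rw [← h]
  refine Finset.sum_congr rfl fun σ _ => ?_
  rw [← Nat.card_eq_fintype_card, ← Nat.card_coe_set_eq]
  refine Nat.card_congr ⟨fun m => ⟨m.1.1, congrArg Subtype.val m.2, m.1.2⟩,
    fun m => ⟨⟨m.1, m.2.2⟩, Subtype.ext m.2.1⟩, fun _ => rfl, fun _ => rfl⟩

theorem relabel_eq_self_iff {V : Type*} (σ : Equiv.Perm V) (m : Multigraph V) :
    m.relabel σ = m ↔ ∀ e, m (pairEquiv σ e) = m e := by
  constructor
  · intro h e
    conv_lhs => rw [← h]
    simp [relabel, Finsupp.equivMapDomain_apply]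
  · intro h
    ext e
    rw [relabel, Finsupp.equivMapDomain_apply, ← h]
    simp

theorem classNum_true_mul_factorial : classNum (fun _ => True) n d * n.factorial =
    ∑ σ : Equiv.Perm (Fin n), (fixedFun (pairEquiv σ : Equiv.Perm (Pair (Fin n))) d).ncard := by
  rw [classNum_mul_factorial]
  simp only [relabel_eq_self_iff, and_true]
  rfl

theorem classNum_simple_mul_factorial : classNum Simple n d * n.factorial =
    ∑ σ : Equiv.Perm (Fin n), (fixedSimple (pairEquiv σ : Equiv.Perm (Pair (Fin n))) d).ncard := by
  rw [classNum_mul_factorial]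
  refine Finset.sum_congr rfl fun σ _ => ?_
  congr 1
  ext m
  simp only [relabel_eq_self_iff, fixedSimple, Set.mem_ofPred_eq, simple_cls, IsSimple]
  tauto

end Burnside

/-! ### Enumeration of cycle types -/

/-- The lists of cycle lengths between `2` and `k + 1` of sum at most `n`. -/
def cycleTypes : ℕ → ℕ → List (List ℕ)
  | 0, _ => [[]]
  | k + 1, n => (List.range (n / (k + 2) + 1)).flatMap fun i =>
      (cycleTypes k (n - i * (k + 2))).map (List.replicate i (k + 2) ++ ·)

/-- Induction on the largest allowed part: `i` is the multiplicity of `k + 2`. Fixed points are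
omitted from cycle types, so the sum is only bounded by `n`. -/
theorem mem_cycleTypes (k n : ℕ) (m : Multiset ℕ) :
    m ∈ (cycleTypes k n).map Multiset.ofList ↔
      (∀ a ∈ m, 2 ≤ a ∧ a ≤ k + 1) ∧ m.sum ≤ n := by
  induction k generalizing n m with
  | zero =>
    simp only [cycleTypes, List.map_cons, List.map_nil, List.mem_singleton, Multiset.coe_nil]
    constructor
    · rintro rfl; simp
    · rintro ⟨h, -⟩
      refine Multiset.eq_zero_of_forall_notMem fun a ha => ?_
      have := h a ha
      omega
  | succ k ih =>
    simp only [cycleTypes, List.map_flatMap, List.map_map, List.mem_flatMap, List.mem_range]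
    have key : ∀ i, m ∈ (cycleTypes k (n - i * (k + 2))).map
        (Multiset.ofList ∘ (List.replicate i (k + 2) ++ ·)) ↔
        ∃ m' ∈ (cycleTypes k (n - i * (k + 2))).map Multiset.ofList,
          Multiset.replicate i (k + 2) + m' = m := by
      intro i
      simp only [List.mem_map, Function.comp_apply, exists_exists_and_eq_and]
      simp only [← Multiset.coe_add, Multiset.coe_replicate]
    simp only [key, ih]
    constructor
    · rintro ⟨i, hi, m', ⟨h1, h2⟩, rfl⟩
      have h3 : i * (k + 2) ≤ n := (Nat.le_div_iff_mul_le (by omega)).1 (by omega)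
      refine ⟨fun a ha => ?_, ?_⟩
      · rcases Multiset.mem_add.1 ha with ha | ha
        · rw [Multiset.eq_of_mem_replicate ha]; omega
        · have := h1 a ha; omega
      · rw [Multiset.sum_add, Multiset.sum_replicate, smul_eq_mul]
        omega
    · rintro ⟨h1, h2⟩
      have hle : Multiset.replicate (m.count (k + 2)) (k + 2) ≤ m :=
        Multiset.le_count_iff_replicate_le.1 le_rfl
      have hadd := add_tsub_cancel_of_le hle
      have hsum : m.count (k + 2) * (k + 2) + (m - Multiset.replicate (m.count (k + 2)) (k + 2)).sum = m.sum := by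
        conv_rhs => rw [← hadd]
        rw [Multiset.sum_add, Multiset.sum_replicate, smul_eq_mul]
      refine ⟨m.count (k + 2), ?_, m - Multiset.replicate (m.count (k + 2)) (k + 2), ⟨fun a ha => ?_, ?_⟩, hadd⟩
      · rw [Nat.lt_succ_iff, Nat.le_div_iff_mul_le (by omega)]
        omega
      · have h3 := h1 a (Multiset.mem_of_le (Multiset.sub_le_self _ _) ha)
        have h4 : a ≠ k + 2 := by
          rintro rfl
          have := Multiset.count_pos.2 ha
          rw [Multiset.count_sub, Multiset.count_replicate_self] at this
          omega
        omega
      · omega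

/-- The branches of the recursion are disjoint because the multiplicity of the largest part recovers
`i`. -/
theorem nodup_cycleTypes (k n : ℕ) : ((cycleTypes k n).map Multiset.ofList).Nodup := by
  induction k generalizing n with
  | zero => simp [cycleTypes]
  | succ k ih =>
    simp only [cycleTypes, List.map_flatMap, List.map_map]
    have key : ∀ i, (cycleTypes k (n - i * (k + 2))).map
        (Multiset.ofList ∘ (List.replicate i (k + 2) ++ ·)) =
        ((cycleTypes k (n - i * (k + 2))).map Multiset.ofList).map
          (Multiset.replicate i (k + 2) + ·) := by
      intro i
      rw [List.map_map]
      rfl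
    simp only [key]
    rw [List.nodup_flatMap]
    refine ⟨fun i _ => (ih _).map (add_right_injective _), ?_⟩
    have hcount : ∀ i m, m ∈ ((cycleTypes k (n - i * (k + 2))).map Multiset.ofList).map
          (Multiset.replicate i (k + 2) + ·) → m.count (k + 2) = i := by
      intro i m hm
      obtain ⟨m', hm', rfl⟩ := List.mem_map.1 hm
      rw [mem_cycleTypes] at hm'
      rw [Multiset.count_add, Multiset.count_replicate_self, Multiset.count_eq_zero_of_notMem, Nat.add_zero]
      intro h
      have := hm'.1 _ h
      omega
    refine List.nodup_range.imp fun {i j} hij m hi hj => hij ?_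
    rw [← hcount i m hi, hcount j m hj]

/-- The number of permutations of `n` points with cycle type `l`. -/
def classSize (n : ℕ) (l : List ℕ) : ℕ :=
  n.factorial / ((n - l.sum).factorial * l.prod * (l.dedup.map fun a => (l.count a).factorial).prod)

theorem sum_cycleType_eq (n : ℕ) (hn : 0 < n) (G : Multiset ℕ → ℕ) :
    ∑ σ : Equiv.Perm (Fin n), G σ.cycleType =
      ((cycleTypes (n - 1) n).map fun l => classSize n l * G l).sum := by
  classical
  have hmaps : ∀ σ ∈ (Finset.univ : Finset (Equiv.Perm (Fin n))), σ.cycleType ∈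
      ((cycleTypes (n - 1) n).map Multiset.ofList).toFinset := by
    intro σ _
    have hsum : σ.cycleType.sum ≤ n := by simpa using σ.sum_cycleType_le
    rw [List.mem_toFinset, mem_cycleTypes]
    refine ⟨fun a ha => ⟨Equiv.Perm.two_le_of_mem_cycleType ha, ?_⟩, hsum⟩
    have := (Multiset.le_sum_of_mem ha).trans hsum
    omega
  rw [← Finset.sum_fiberwise_of_maps_to hmaps, List.sum_toFinset _ (nodup_cycleTypes _ _), List.map_map]
  congr 1
  refine List.map_congr_left fun l hl => ?_
  have hl' := (mem_cycleTypes (n - 1) n l).1 (List.mem_map.2 ⟨l, hl, rfl⟩)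
  rw [Function.comp_apply, Finset.sum_congr rfl (g := fun _ => G l)
    fun σ hσ => congrArg G (Finset.mem_filter.1 hσ).2, Finset.sum_const, smul_eq_mul,
    Equiv.Perm.card_of_cycleType, if_pos]
  · rw [Fintype.card_fin, classSize]
    congr 3
    simp only [Multiset.coe_count]
    rfl
  · rw [Fintype.card_fin]
    exact ⟨hl'.2, fun a ha => (hl'.1 a ha).1⟩

/-! ### Computing the numbers of classes -/

/-- The scalar product of two lists. -/
def dot : List ℕ → List ℕ → ℕ
  | a :: l, b :: l' => a * b + dot l l'
  | _, _ => 0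

theorem dot_map_range (s f : ℕ → ℕ) (D e : ℕ) (h : e ≤ D) :
    dot ((List.range D).map s) ((List.range e).map f) = ∑ k ∈ Finset.range e, s k * f k := by
  induction e generalizing s f D with
  | zero => cases D <;> simp [dot]
  | succ e ih =>
    obtain ⟨D, rfl⟩ : ∃ D', D = D' + 1 := ⟨D - 1, by omega⟩
    rw [List.range_succ_eq_map, List.range_succ_eq_map, List.map_cons, List.map_cons, dot,
      List.map_map, List.map_map, ih _ _ D (by omega), Finset.sum_range_succ', Nat.add_comm]
    rfl

/-- The values `N d, …, N 0` of the sequence with `N 0 = 1` and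
`d * N d = ∑ k < d, s k * N (d - (k + 1))`. -/
def eulerRev (s : List ℕ) : ℕ → List ℕ
  | 0 => [1]
  | d + 1 => (dot s (eulerRev s d) / (d + 1)) :: eulerRev s d

theorem map_range_succ_sub (N : ℕ → ℕ) (d : ℕ) :
    (List.range (d + 1 + 1)).map (fun i => N (d + 1 - i)) =
      N (d + 1) :: (List.range (d + 1)).map (fun i => N (d - i)) := by
  rw [List.range_succ_eq_map (n := d + 1), List.map_cons, List.map_map]
  congr 1
  refine List.map_congr_left fun i _ => ?_
  simp

/-- The division in `eulerRev` is exact because the recursion holds in `ℕ`. Listing the values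
backwards turns the convolution into a scalar product, in which surplus entries of `s` are dropped.
-/
theorem eulerRev_eq (N s : ℕ → ℕ) (h0 : N 0 = 1)
    (h : ∀ d, d * N d = ∑ k ∈ Finset.range d, s k * N (d - (k + 1))) (D d : ℕ) (hd : d ≤ D) :
    eulerRev ((List.range D).map s) d = (List.range (d + 1)).map fun i => N (d - i) := by
  induction d with
  | zero => simp [eulerRev, h0]
  | succ d ih =>
    rw [eulerRev, ih (by omega), map_range_succ_sub, dot_map_range _ _ _ _ hd]
    congr 1
    have := h (d + 1)
    simp only [Nat.add_sub_add_right] at this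
    rw [← this, Nat.mul_div_cancel_left _ d.succ_pos]

/-- The number of points fixed by the `k`-th power of a permutation with cycle type `l`. -/
def fixPow (n : ℕ) (l : List ℕ) (k : ℕ) : ℕ :=
  n - (l.map fun p => if k % p = 0 then 0 else p).sum

/-- The number of pairs fixed by the `k`-th power of a permutation with cycle type `l`. -/
def pairFix (n : ℕ) (l : List ℕ) (k : ℕ) : ℕ :=
  (fixPow n l k * fixPow n l k + fixPow n l (2 * k) - 2 * fixPow n l k) / 2

/-- The numbers of multigraphs with `D, …, 0` edges fixed by a permutation with cycle type `l`. -/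
def multRow (n D : ℕ) (l : List ℕ) : List ℕ :=
  eulerRev ((List.range D).map fun k => pairFix n l (k + 1)) D

/-- Removal of the squares of the variables: the values `S d, …, S 0` with
`M d = ∑ b, M b * S (d - 2 * b)`. -/
def squarefreeRev (M q : List ℕ) : ℕ → List ℕ
  | 0 => [1]
  | d + 1 => (M.getD (d + 1) 0 - dot q (squarefreeRev M q d)) :: squarefreeRev M q d

/-- The numbers of simple graphs with `D, …, 0` edges fixed by a permutation with cycle type `l`. -/
def simpleRow (n D : ℕ) (l : List ℕ) : List ℕ :=
  let M := (multRow n D l).reverse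
  squarefreeRev M ((List.range D).map fun k =>
    if (k + 1) % 2 = 0 then M.getD ((k + 1) / 2) 0 else 0) D

/-- The sum of two lists of the same length. -/
def addRow : List ℕ → List ℕ → List ℕ
  | a :: l, b :: l' => (a + b) :: addRow l l'
  | _, _ => []

/-- The numbers of unlabelled multigraphs with `n` vertices and `D, …, 0` edges, from the numbers
of multigraphs fixed by a permutation with given cycle type. -/
def classRow (row : List ℕ → List ℕ) (n D : ℕ) : List ℕ :=
  ((cycleTypes (n - 1) n).foldr (fun l acc => addRow ((row l).map (classSize n l * ·)) acc)
    (List.replicate (D + 1) 0)).map (· / n.factorial)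

section
variable {n : ℕ} {σ : Equiv.Perm (Fin n)} {l : List ℕ} (h : (l : Multiset ℕ) = σ.cycleType)
include h

theorem fixPow_eq (k : ℕ) : fixPow n l k = fixCount (σ ^ k) := by
  rw [fixCount_pow, ← h, Fintype.card_fin]
  rfl

theorem pairFix_eq (k : ℕ) :
    pairFix n l k = fixCount ((pairEquiv σ : Equiv.Perm (Pair (Fin n))) ^ k) := by
  have := two_mul_fixCount_pairEquiv (σ ^ k)
  rw [← pow_mul, Nat.mul_comm k 2] at this
  rw [pairFix, fixPow_eq h, fixPow_eq h, pairEquiv_pow]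
  omega

theorem multRow_eq (D : ℕ) : multRow n D l = (List.range (D + 1)).map fun i =>
    (fixedFun (pairEquiv σ : Equiv.Perm (Pair (Fin n))) (D - i)).ncard := by
  rw [multRow, eulerRev_eq (fun d => (fixedFun (pairEquiv σ : Equiv.Perm (Pair (Fin n))) d).ncard)
    (fun k => pairFix n l (k + 1)) (ncard_fixedFun_zero _) ?_ D D le_rfl]
  intro d
  simp only [pairFix_eq h]
  exact mul_ncard_fixedFun _ d

/-- The relation `M d = ∑ M b * S (d - 2 b)` is solved for its term `b = 0`, which is `S d` since `M
0 = 1`. -/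
theorem simpleRow_eq (D : ℕ) : simpleRow n D l = (List.range (D + 1)).map fun i =>
    (fixedSimple (pairEquiv σ : Equiv.Perm (Pair (Fin n))) (D - i)).ncard := by
  set M := fun d => (fixedFun (pairEquiv σ : Equiv.Perm (Pair (Fin n))) d).ncard with hM
  set S := fun d => (fixedSimple (pairEquiv σ : Equiv.Perm (Pair (Fin n))) d).ncard with hS
  have hMget : ∀ d ≤ D, (multRow n D l).reverse.getD d 0 = M d := by
    intro d hd
    have hlen : d < (multRow n D l).reverse.length := by
      rw [multRow_eq h]
      simpa using Nat.lt_succ_of_le hd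
    rw [List.getD_eq_getElem _ _ hlen]
    simp only [multRow_eq h, List.getElem_reverse, List.getElem_map, List.getElem_range,
      List.length_map, List.length_range]
    rw [show D - (D + 1 - 1 - d) = d by omega]
  have hrel : ∀ d, M d = ∑ b ∈ Finset.range (d / 2 + 1), M b * S (d - 2 * b) :=
    ncard_fixedFun_eq_sum_simple _
  have hM0 : M 0 = 1 := ncard_fixedFun_zero _
  -- Spreads the terms with `b ≥ 1` over all shifts `k + 1`, with zeros at the odd ones, so that
  -- they form a scalar product as in `squarefreeRev`.
  have hsum : ∀ d, ∑ k ∈ Finset.range d,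
      (if (k + 1) % 2 = 0 then M ((k + 1) / 2) else 0) * S (d - (k + 1)) =
      ∑ b ∈ Finset.range (d / 2), M (b + 1) * S (d - 2 * (b + 1)) := by
    intro d
    simp only [ite_mul, Nat.zero_mul]
    rw [← Finset.sum_filter]
    symm
    refine Finset.sum_nbij' (fun b => 2 * b + 1) (fun k => k / 2) ?_ ?_ ?_ ?_ ?_
    · intro b hb
      simp only [Finset.mem_range, Finset.mem_filter] at hb ⊢
      omega
    · intro k hk
      simp only [Finset.mem_range, Finset.mem_filter] at hk ⊢
      omega
    · intro b _
      omega
    · intro k hk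
      simp only [Finset.mem_range, Finset.mem_filter] at hk ⊢
      omega
    · intro b _
      rw [show (2 * b + 1 + 1) / 2 = b + 1 by omega, show 2 * b + 1 + 1 = 2 * (b + 1) by omega]
  have hmain : ∀ d ≤ D, squarefreeRev (multRow n D l).reverse ((List.range D).map fun k =>
      if (k + 1) % 2 = 0 then (multRow n D l).reverse.getD ((k + 1) / 2) 0 else 0) d =
      (List.range (d + 1)).map fun i => S (d - i) := by
    intro d hd
    have hq : ((List.range D).map fun k =>
        if (k + 1) % 2 = 0 then (multRow n D l).reverse.getD ((k + 1) / 2) 0 else 0) =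
        (List.range D).map fun k => if (k + 1) % 2 = 0 then M ((k + 1) / 2) else 0 := by
      refine List.map_congr_left fun k hk => ?_
      have := List.mem_range.1 hk
      rw [hMget _ (by omega)]
    rw [hq]
    induction d with
    | zero =>
      have := hrel 0
      simp [hM0] at this
      simp [squarefreeRev, ← this]
    | succ d ih =>
      rw [squarefreeRev, ih (by omega), map_range_succ_sub, dot_map_range _ _ _ _ hd, hMget _ hd]
      congr 1
      have h1 := hrel (d + 1)
      have h2 := hsum (d + 1)
      simp only [Nat.add_sub_add_right] at h2
      rw [Finset.sum_range_succ', ← h2, hM0] at h1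
      rw [h1]
      simp
  exact hmain D le_rfl

end

theorem foldr_addRow {ι : Type*} (L : List ι) (f : ι → ℕ → ℕ) (e : ℕ) :
    L.foldr (fun l acc => addRow ((List.range e).map (f l)) acc) (List.replicate e 0) =
      (List.range e).map fun i => (L.map (f · i)).sum := by
  have hadd : ∀ (e : ℕ) (a b : ℕ → ℕ), addRow ((List.range e).map a) ((List.range e).map b) =
      (List.range e).map fun i => a i + b i := by
    intro e
    induction e with
    | zero => simp [addRow]
    | succ e ih =>
      intro a b
      rw [List.range_succ_eq_map, List.map_cons, List.map_cons, List.map_cons, addRow,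
        List.map_map, List.map_map, List.map_map, ih]
      rfl
  induction L with
  | nil => simp
  | cons l L ih => rw [List.foldr_cons, ih, hadd]; simp

/-- By `hrow` the number of fixed objects depends only on the cycle type, so the Burnside sum
collapses to a sum over cycle types weighted by the sizes of the conjugacy classes. -/
theorem classRow_eq (row : List ℕ → List ℕ) (n D : ℕ) (hn : 0 < n) (P : Cls → Prop)
    (F : Equiv.Perm (Fin n) → ℕ → ℕ)
    (hrow : ∀ (σ : Equiv.Perm (Fin n)) (l : List ℕ), (l : Multiset ℕ) = σ.cycleType →
      row l = (List.range (D + 1)).map fun i => F σ (D - i))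
    (hP : ∀ d, classNum P n d * n.factorial = ∑ σ : Equiv.Perm (Fin n), F σ d) :
    classRow row n D = (List.range (D + 1)).map fun i => classNum P n (D - i) := by
  classical
  -- `G` evaluates `F` at an arbitrary permutation of the given cycle type. The default 0 is never
  -- used, since every type in the enumeration is realised.
  let G : ℕ → Multiset ℕ → ℕ := fun i m =>
    if h : ∃ σ : Equiv.Perm (Fin n), σ.cycleType = m then F h.choose (D - i) else 0
  have hFG : ∀ σ, ∀ i ∈ List.range (D + 1), F σ (D - i) = G i σ.cycleType := by
    intro σ i hi
    have hex : ∃ τ : Equiv.Perm (Fin n), τ.cycleType = σ.cycleType := ⟨σ, rfl⟩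
    simp only [G, dif_pos hex]
    have h1 := hrow σ σ.cycleType.toList (Multiset.coe_toList _)
    have h2 := hrow hex.choose σ.cycleType.toList (by rw [hex.choose_spec, Multiset.coe_toList])
    exact List.map_inj_left.1 (h1.symm.trans h2) i hi
  have hl : ∀ l ∈ cycleTypes (n - 1) n, (row l).map (classSize n l * ·) =
      (List.range (D + 1)).map fun i => classSize n l * G i l := by
    intro l hl
    have hm := (mem_cycleTypes (n - 1) n l).1 (List.mem_map.2 ⟨l, hl, rfl⟩)
    obtain ⟨σ, hσ⟩ := (Equiv.Perm.exists_with_cycleType_iff (Fin n)).2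
      ⟨by simpa using hm.2, fun a ha => (hm.1 a ha).1⟩
    rw [hrow σ l hσ.symm, List.map_map]
    refine List.map_congr_left fun i hi => ?_
    rw [Function.comp_apply, hFG σ i hi, hσ]
  rw [classRow, List.foldr_ext _ (fun l acc =>
      addRow ((List.range (D + 1)).map fun i => classSize n l * G i l) acc) _
    fun l hl' acc => by rw [hl l hl'], foldr_addRow, List.map_map]
  refine List.map_congr_left fun i hi => ?_
  rw [Function.comp_apply, ← sum_cycleType_eq n hn (G i), ← Finset.sum_congr rfl fun σ _ => hFG σ i hi,
    ← hP, Nat.mul_div_cancel _ n.factorial_pos]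

theorem classRow_multRow (n D : ℕ) (hn : 0 < n) : classRow (multRow n D) n D =
    (List.range (D + 1)).map fun i => classNum (fun _ => True) n (D - i) :=
  classRow_eq _ n D hn _ _ (fun _ _ h => multRow_eq h D) fun d => classNum_true_mul_factorial n d

theorem classRow_simpleRow (n D : ℕ) (hn : 0 < n) : classRow (simpleRow n D) n D =
    (List.range (D + 1)).map fun i => classNum Simple n (D - i) :=
  classRow_eq _ n D hn _ _ (fun _ _ h => simpleRow_eq h D) fun d => classNum_simple_mul_factorial n d

/-! ### The Euler transform -/

/-- A class of multigraphs that is determined by the connected components. -/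
def Componentwise (P : Cls → Prop) : Prop := ∀ x, (∀ y ∈ components x, P y) ↔ P x

theorem componentwise_true : Componentwise fun _ => True := by simp [Componentwise]

theorem componentwise_simple : Componentwise Simple := simple_components

/-- The number of connected classes in `P` with `n` vertices and `e` edges. -/
def connNum (P : Cls → Prop) (n e : ℕ) : ℕ := {x | Conn x ∧ nv x = n ∧ ne x = e ∧ P x}.ncard

theorem finite_nv_ne (N D : ℕ) : {x : Cls | nv x ≤ N ∧ ne x ≤ D}.Finite := by
  have hf : ({p : Σ N : ℕ, Multigraph (Fin N) | p.1 ≤ N ∧ p.2.degree ≤ D}).Finite := by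
    have : {p : Σ N : ℕ, Multigraph (Fin N) | p.1 ≤ N ∧ p.2.degree ≤ D} ⊆
        ⋃ n ∈ Set.Iic N, ⋃ d ∈ Set.Iic D, Sigma.mk n '' {m : Multigraph (Fin n) | m.degree = d} := by
      rintro ⟨n, m⟩ ⟨h1, h2⟩
      simp only [Set.mem_iUnion, Set.mem_Iic]
      exact ⟨n, h1, _, h2, m, rfl, rfl⟩
    refine Set.Finite.subset ?_ this
    exact (Set.finite_Iic N).biUnion fun n _ => (Set.finite_Iic D).biUnion fun d _ =>
      (finite_degree_eq d).image _
  refine (hf.image fun p => cls p.2).subset ?_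
  rintro x ⟨h1, h2⟩
  obtain ⟨n, m, rfl⟩ := exists_rep x
  rw [nv_cls, Fintype.card_fin] at h1
  rw [ne_cls] at h2
  exact ⟨⟨n, m⟩, ⟨h1, h2⟩, rfl⟩

/-- Taking components is a bijection from classes to multisets of connected classes, and `hw` says
that it respects the weight. -/
theorem ncard_eq_msSet {A : Type*} [AddCancelCommMonoid A] (w : Cls → A) (a : A) (Q : Cls → Prop)
    (hw : ∀ x, ((components x).map w).sum = w x) :
    {x | w x = a ∧ ∀ y ∈ components x, Q y}.ncard = (msSet {x | Conn x ∧ Q x} w a).ncard := by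
  refine Set.ncard_congr (fun x _ => components x) ?_ ?_ ?_
  · rintro x ⟨h1, h2⟩
    exact ⟨fun y hy => ⟨conn_of_mem_components hy, h2 y hy⟩, (hw x).trans h1⟩
  · intro x y _ _ h
    exact components_injective h
  · rintro μ ⟨h1, h2⟩
    obtain ⟨x, rfl⟩ := exists_components_eq μ fun y hy => (h1 y hy).1
    exact ⟨x, ⟨(hw x).symm.trans h2, fun y hy => (h1 y hy).2⟩, rfl⟩

/-- The decompositions of a pair of natural numbers into two summands. -/
@[reducible] def natProdAntidiagonal : Finset.HasAntidiagonal (ℕ × ℕ) where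
  antidiagonal a := (Finset.range (a.1 + 1) ×ˢ Finset.range (a.2 + 1)).image
    fun p => (p, (a.1 - p.1, a.2 - p.2))
  mem_antidiagonal := by
    rintro ⟨n, e⟩ ⟨⟨k, l⟩, ⟨k', l'⟩⟩
    simp only [Finset.mem_image, Finset.mem_product, Finset.mem_range, Prod.mk.injEq, Prod.mk_add_mk,
      Prod.exists]
    constructor
    · rintro ⟨a, b, h, ⟨rfl, rfl⟩, rfl, rfl⟩
      omega
    · rintro ⟨rfl, rfl⟩
      exact ⟨k, l, by omega, ⟨rfl, rfl⟩, by omega, by omega⟩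

/-- The coefficients of the logarithmic derivative in terms of the numbers of connected classes. -/
def logSum (c : ℕ → ℕ → ℕ) (k l : ℕ) : ℕ :=
  ((List.range k).map fun j =>
    if k % (j + 1) = 0 ∧ l % (j + 1) = 0 then k / (j + 1) * c (k / (j + 1)) (l / (j + 1)) else 0).sum

theorem list_sum_range (f : ℕ → ℕ) (n : ℕ) : ((List.range n).map f).sum = ∑ i ∈ Finset.range n, f i := rfl

theorem nsmul_eq_iff {j n k : ℕ} (hj : 0 < j) : j * n = k ↔ k % j = 0 ∧ n = k / j := by
  constructor
  · rintro rfl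
    exact ⟨Nat.mul_mod_right j n, (Nat.mul_div_cancel_left n hj).symm⟩
  · rintro ⟨h, rfl⟩
    exact Nat.mul_div_cancel' (Nat.dvd_of_mod_eq_zero h)

/-- The Euler transform, graded by vertices and edges. The derivation counts vertices, because the
one-vertex component has no edge and would have weight zero in the other grading. -/
theorem mul_classNum {P : Cls → Prop} (hP : Componentwise P) (n e : ℕ) :
    n * classNum P n e = ∑ k ∈ Finset.range (n + 1), ∑ l ∈ Finset.range (e + 1),
      logSum (connNum P) k l * classNum P (n - k) (e - l) := by
  classical
  let w : Cls → ℕ × ℕ := fun x => (nv x, ne x)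
  have hw : ∀ x, ((components x).map w).sum = w x := by
    intro x
    refine Prod.ext ?_ ?_
    · exact (map_multiset_sum (AddMonoidHom.fst ℕ ℕ) _).trans (by rw [Multiset.map_map]; exact sum_nv_components x)
    · exact (map_multiset_sum (AddMonoidHom.snd ℕ ℕ) _).trans (by rw [Multiset.map_map]; exact sum_ne_components x)
  -- There are infinitely many connected classes; only those within the bounds `n` and `e` can
  -- occur, so a finite set replaces them.
  have hfin : {x : Cls | Conn x ∧ nv x ≤ n ∧ ne x ≤ e ∧ P x}.Finite :=
    (finite_nv_ne n e).subset fun x h => ⟨h.2.1, h.2.2.1⟩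
  set S := hfin.toFinset with hS
  have hmemS : ∀ x, x ∈ S ↔ Conn x ∧ nv x ≤ n ∧ ne x ≤ e ∧ P x := by simp [hS]
  have hclass : ∀ n' ≤ n, ∀ e' ≤ e, classNum P n' e' = (msSet (S : Set Cls) w (n', e')).ncard := by
    intro n' hn' e' he'
    have h1 : {x | nv x = n' ∧ ne x = e' ∧ P x} = {x | w x = (n', e') ∧ ∀ y ∈ components x, P y} := by
      ext x
      simp only [Set.mem_ofPred_eq, hP x, w, Prod.mk.injEq, and_assoc]
    rw [classNum, h1, ncard_eq_msSet w _ P hw]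
    congr 1
    ext μ
    refine and_congr_left fun hμ => forall₂_congr fun x hx => ?_
    have h1 := congrArg Prod.fst hμ
    have h2 := congrArg Prod.snd hμ
    have h3 : nv x ≤ (μ.map nv).sum := Multiset.single_le_sum (by simp) _ (Multiset.mem_map_of_mem _ hx)
    have h4 : ne x ≤ (μ.map ne).sum := Multiset.single_le_sum (by simp) _ (Multiset.mem_map_of_mem _ hx)
    have h5 : (μ.map w).sum.1 = (μ.map nv).sum :=
      (map_multiset_sum (AddMonoidHom.fst ℕ ℕ) _).trans (by rw [Multiset.map_map]; rfl)
    have h6 : (μ.map w).sum.2 = (μ.map ne).sum :=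
      (map_multiset_sum (AddMonoidHom.snd ℕ ℕ) _).trans (by rw [Multiset.map_map]; rfl)
    rw [Finset.mem_coe, hmemS]
    constructor
    · rintro ⟨h, h'⟩
      dsimp only at h1 h2
      exact ⟨h, by omega, by omega, h'⟩
    · rintro ⟨h, -, -, h'⟩
      exact ⟨h, h'⟩
  have hlog : ∀ k ≤ n, ∀ l ≤ e, logCoeff (AddMonoidHom.fst ℕ ℕ) S w (k, l) = logSum (connNum P) k l := by
    intro k hk l hl
    have hconn : ∀ k' ≤ n, ∀ l' ≤ e, connNum P k' l' = (S.filter fun x => nv x = k' ∧ ne x = l').card := by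
      intro k' hk' l' hl'
      rw [connNum, ← Set.ncard_coe_finset]
      congr 1
      ext x
      simp only [Finset.coe_filter, hmemS, Set.mem_ofPred_eq]
      constructor
      · rintro ⟨h1, rfl, rfl, h2⟩
        exact ⟨⟨h1, hk', hl', h2⟩, rfl, rfl⟩
      · rintro ⟨⟨h1, -, -, h2⟩, rfl, rfl⟩
        exact ⟨h1, rfl, rfl, h2⟩
    rw [logCoeff, logSum, list_sum_range]
    have h1 : ∀ x, ((Finset.Icc 1 ((AddMonoidHom.fst ℕ ℕ) (k, l))).filter fun j => j • w x = (k, l)).card =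
        ∑ j ∈ Finset.range k, if (j + 1) * nv x = k ∧ (j + 1) * ne x = l then 1 else 0 := by
      intro x
      rw [Finset.card_filter, Finset.sum_bij' (fun j _ => j - 1) (fun j _ => j + 1)]
      · simp only [Finset.mem_Icc, Finset.mem_range, AddMonoidHom.coe_fst]; omega
      · simp only [Finset.mem_Icc, Finset.mem_range, AddMonoidHom.coe_fst]; omega
      · simp only [Finset.mem_Icc]; omega
      · simp
      · intro j hj
        simp only [Finset.mem_Icc] at hj
        simp only [w, Prod.smul_mk, smul_eq_mul, Prod.mk.injEq, Nat.sub_add_cancel hj.1]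
    simp only [h1, Finset.mul_sum]
    rw [Finset.sum_comm]
    refine Finset.sum_congr rfl fun j _ => ?_
    simp only [nsmul_eq_iff j.succ_pos]
    split_ifs with hd
    · rw [hconn _ ((Nat.div_le_self _ _).trans hk) _ ((Nat.div_le_self _ _).trans hl), Finset.card_filter, Finset.mul_sum]
      refine Finset.sum_congr rfl fun x _ => ?_
      by_cases hx : nv x = k / (j + 1) ∧ ne x = l / (j + 1)
      · rw [if_pos hx, if_pos ⟨⟨hd.1, hx.1⟩, hd.2, hx.2⟩, ← hx.1]
        rfl
      · rw [if_neg hx, if_neg fun h => hx ⟨h.1.2, h.2.2⟩, Nat.mul_zero, Nat.mul_zero]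
    · refine Finset.sum_eq_zero fun x _ => ?_
      rw [if_neg fun h => hd ⟨h.1.1, h.2.1⟩, Nat.mul_zero]
  let _ : Finset.HasAntidiagonal (ℕ × ℕ) := natProdAntidiagonal
  have h := mul_ncard_msSet (S := S) (w := w) (AddMonoidHom.fst ℕ ℕ)
    (fun x hx => ((hmemS x).1 hx).1.nv_pos) (n, e)
  rw [← hclass n le_rfl e le_rfl] at h
  refine h.trans ?_
  change ∑ p ∈ (Finset.range (n + 1) ×ˢ Finset.range (e + 1)).image _, _ = _
  rw [Finset.sum_image fun a _ b _ h => congrArg Prod.fst h, Finset.sum_product]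
  refine Finset.sum_congr rfl fun k hk => Finset.sum_congr rfl fun l hl => ?_
  rw [Finset.mem_range, Nat.lt_succ_iff] at hk hl
  rw [hlog k hk l hl, hclass _ (Nat.sub_le _ _) _ (Nat.sub_le _ _)]

theorem classNum_zero {P : Cls → Prop} (hP : Componentwise P) (e : ℕ) :
    classNum P 0 e = if e = 0 then 1 else 0 := by
  have key : ∀ x, nv x = 0 → components x = 0 := by
    intro x hx
    refine Multiset.eq_zero_of_forall_notMem fun y hy => ?_
    have h1 := Multiset.single_le_sum (by simp) _ (Multiset.mem_map_of_mem nv hy)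
    rw [sum_nv_components, hx] at h1
    exact absurd (conn_of_mem_components hy).nv_pos (by omega)
  have hne : ∀ x, nv x = 0 → ne x = 0 := by
    intro x hx
    rw [← sum_ne_components, key x hx]
    simp
  split_ifs with h
  · subst h
    rw [classNum, Set.ncard_eq_one]
    obtain ⟨x, hx⟩ := exists_components_eq 0 (by simp)
    have h0 : nv x = 0 := by rw [← sum_nv_components, hx]; simp
    refine ⟨x, Set.eq_singleton_iff_unique_mem.2 ⟨⟨h0, hne x h0, (hP x).1 (by simp [hx])⟩, ?_⟩⟩
    rintro y ⟨hy, -, -⟩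
    exact components_injective ((key y hy).trans hx.symm)
  · rw [classNum, Set.ncard_eq_zero ((finite_nv_ne 0 e).subset fun x h => ⟨h.1.le, h.2.1.le⟩),
      Set.eq_empty_iff_forall_notMem]
    rintro x ⟨h1, h2, -⟩
    exact h (h2.symm.trans (hne x h1))

/-- In the recursion for `n` vertices the unknown `n * c n e` occurs once, for `k = n` and `j = 0`,
and everything else involves fewer vertices. The recursion thus determines the numbers of connected
classes, and a proposed table only has to be tested. -/
theorem connNum_eq_of_recursion {P : Cls → Prop} (hP : Componentwise P) (N D : ℕ) (c : ℕ → ℕ → ℕ)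
    (h : ∀ n ≤ N, 0 < n → ∀ e ≤ D, n * classNum P n e = ∑ k ∈ Finset.range (n + 1),
      ∑ l ∈ Finset.range (e + 1), logSum c k l * classNum P (n - k) (e - l)) :
    ∀ n ≤ N, 0 < n → ∀ e ≤ D, connNum P n e = c n e := by
  intro n
  induction n using Nat.strong_induction_on with
  | _ n ih =>
  intro hn hn0 e he
  have hlog : ∀ k < n, ∀ l ≤ D, logSum c k l = logSum (connNum P) k l := by
    intro k hk l hl
    rw [logSum, logSum]
    congr 1
    refine List.map_congr_left fun j hj => ?_
    have hj := List.mem_range.1 hj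
    split_ifs with hd
    · rw [ih (k / (j + 1)) ((Nat.div_le_self _ _).trans_lt hk) (by have := Nat.div_le_self k (j + 1); omega)
        (Nat.div_pos hj j.succ_pos) _ ((Nat.div_le_self _ _).trans hl)]
    · rfl
  have h1 := (mul_classNum hP n e).symm.trans (h n hn hn0 e he)
  rw [Finset.sum_range_succ (fun k => ∑ l ∈ Finset.range (e + 1),
      logSum (connNum P) k l * classNum P (n - k) (e - l)),
    Finset.sum_range_succ (fun k => ∑ l ∈ Finset.range (e + 1),
      logSum c k l * classNum P (n - k) (e - l))] at h1
  rw [Finset.sum_congr rfl fun k hk => Finset.sum_congr rfl fun l hl => by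
    rw [← hlog k (Finset.mem_range.1 hk) l (by have := Finset.mem_range.1 hl; omega)]] at h1
  have h2 := Nat.add_left_cancel h1
  -- In the block `k = n` the remaining factor counts classes without vertices, which is 1 for zero
  -- edges and 0 otherwise; only `l = e` survives.
  have hlast : ∀ c' : ℕ → ℕ → ℕ, ∑ l ∈ Finset.range (e + 1), logSum c' n l * classNum P (n - n) (e - l) =
      logSum c' n e := by
    intro c'
    rw [Nat.sub_self, Finset.sum_range_succ, Nat.sub_self, classNum_zero hP, Finset.sum_eq_zero]
    · simp
    · intro l hl
      have := Finset.mem_range.1 hl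
      rw [classNum_zero hP, if_neg (by omega), Nat.mul_zero]
  rw [hlast, hlast, logSum, logSum] at h2
  obtain ⟨n, rfl⟩ : ∃ m, n = m + 1 := ⟨n - 1, by omega⟩
  rw [List.range_succ_eq_map, List.map_cons, List.map_cons, List.sum_cons, List.sum_cons] at h2
  rw [List.map_congr_left (l := List.map Nat.succ (List.range n)) (g := fun j =>
    if (n + 1) % (j + 1) = 0 ∧ e % (j + 1) = 0 then
      (n + 1) / (j + 1) * c ((n + 1) / (j + 1)) (e / (j + 1)) else 0)] at h2
  · have h3 := Nat.add_right_cancel h2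
    simpa [Nat.mod_one] using h3
  · intro j hj
    obtain ⟨i, hi, rfl⟩ := List.mem_map.1 hj
    have hi := List.mem_range.1 hi
    split_ifs with hd
    · rw [ih _ (Nat.div_lt_self n.succ_pos (by omega)) ((Nat.div_le_self _ _).trans hn)
        (Nat.div_pos (by omega) (by omega)) _ ((Nat.div_le_self _ _).trans he)]
    · rfl

/-! ### Multisets of connected classes counted by edges -/

/-- The connected classes in `P` with between `2` and `N` vertices. -/
def connSet (P : Cls → Prop) (N : ℕ) : Set Cls := {x | Conn x ∧ 2 ≤ nv x ∧ nv x ≤ N ∧ P x}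

/-- The number of multisets of connected classes in `P` with between `2` and `N` vertices, having
`d` edges in total. -/
def multisetNum (P : Cls → Prop) (N d : ℕ) : ℕ := (msSet (connSet P N) ne d).ncard

theorem ne_pos_of_mem_connSet {P : Cls → Prop} {N : ℕ} {x : Cls} (h : x ∈ connSet P N) : 0 < ne x :=
  h.1.ne_pos (by have := h.2.1; omega)

/-- The coefficients of the logarithmic derivative in terms of the numbers of connected classes,
forgetting the number of vertices. -/
def logSumEdges (c : ℕ → ℕ → ℕ) (N k : ℕ) : ℕ :=
  ((List.range k).map fun j => if k % (j + 1) = 0 then k / (j + 1) *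
    ((List.range (N - 1)).map fun i => c (i + 2) (k / (j + 1))).sum else 0).sum

theorem msSet_connSet_eq (P : Cls → Prop) (N D d : ℕ) (hd : d ≤ D) :
    msSet (connSet P N) ne d = msSet (connSet P N ∩ {x | ne x ≤ D}) ne d := by
  ext μ
  refine and_congr_left fun hμ => forall₂_congr fun x hx => ?_
  have h4 : ne x ≤ (μ.map ne).sum := Multiset.single_le_sum (by simp) _ (Multiset.mem_map_of_mem _ hx)
  have : ne x ≤ D := by omega
  exact ⟨fun h => ⟨h, this⟩, fun h => h.1⟩

theorem finite_msSet_connSet (P : Cls → Prop) (N d : ℕ) : (msSet (connSet P N) ne d).Finite := by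
  have hfin : (connSet P N ∩ {x | ne x ≤ d}).Finite :=
    (finite_nv_ne N d).subset fun x h => ⟨h.1.2.2.1, h.2⟩
  rw [msSet_connSet_eq P N d d le_rfl, ← hfin.coe_toFinset]
  exact finite_msSet (AddMonoidHom.id ℕ) (fun x hx => ne_pos_of_mem_connSet (hfin.mem_toFinset.1 hx).1) d

theorem multisetNum_zero (P : Cls → Prop) (N : ℕ) : multisetNum P N 0 = 1 :=
  ncard_msSet_zero (AddMonoidHom.id ℕ) fun _ hx => ne_pos_of_mem_connSet hx

/-- The Euler transform in the number of edges alone. Excluding the one-vertex class makes edges a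
positive weight. -/
theorem mul_multisetNum (P : Cls → Prop) (N d : ℕ) :
    d * multisetNum P N d = ∑ k ∈ Finset.range d,
      logSumEdges (connNum P) N (k + 1) * multisetNum P N (d - (k + 1)) := by
  classical
  have hfin : (connSet P N ∩ {x | ne x ≤ d}).Finite :=
    (finite_nv_ne N d).subset fun x h => ⟨h.1.2.2.1, h.2⟩
  set S := hfin.toFinset with hS
  have hmemS : ∀ x, x ∈ S ↔ x ∈ connSet P N ∧ ne x ≤ d := by simp [hS]
  have hnum : ∀ d' ≤ d, multisetNum P N d' = (msSet (S : Set Cls) ne d').ncard := by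
    intro d' hd'
    rw [multisetNum, msSet_connSet_eq P N d d' hd', hS, hfin.coe_toFinset]
  have h := mul_ncard_msSet (S := S) (w := ne) (AddMonoidHom.id ℕ)
    (fun x hx => ne_pos_of_mem_connSet ((hmemS x).1 hx).1) d
  rw [Finset.Nat.sum_antidiagonal_eq_sum_range_succ
    (fun i j => logCoeff (AddMonoidHom.id ℕ) S ne i * (msSet (S : Set Cls) ne j).ncard),
    Finset.sum_range_succ', ← hnum d le_rfl] at h
  have h0 : logCoeff (AddMonoidHom.id ℕ) S ne 0 = 0 := by
    simp [logCoeff]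
  rw [h0, Nat.zero_mul, Nat.add_zero] at h
  refine h.trans (Finset.sum_congr rfl fun k hk => ?_)
  rw [hnum _ (Nat.sub_le _ _)]
  congr 1
  have hkd : k + 1 ≤ d := Finset.mem_range.1 hk
  generalize k + 1 = k at hkd
  -- The index `i` stands for `i + 2` vertices, so its `N - 1` values cover the sizes from 2 to `N`.
  have hconn : ∀ e ≤ d, ∑ i ∈ Finset.range (N - 1), connNum P (i + 2) e =
      (S.filter fun x => ne x = e).card := by
    intro e he
    rw [Finset.card_eq_sum_card_fiberwise (f := fun x => nv x - 2) (t := Finset.range (N - 1))]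
    · refine Finset.sum_congr rfl fun i hi => ?_
      have hi := Finset.mem_range.1 hi
      rw [connNum, ← Set.ncard_coe_finset]
      congr 1
      ext x
      simp only [Finset.coe_filter, Finset.mem_filter, hmemS, Set.mem_ofPred_eq, connSet]
      constructor
      · rintro ⟨h1, h2, rfl, h3⟩
        exact ⟨⟨⟨⟨h1, by omega, by omega, h3⟩, he⟩, rfl⟩, by omega⟩
      · rintro ⟨⟨⟨⟨h1, h2, h3, h4⟩, -⟩, rfl⟩, h5⟩
        exact ⟨h1, by omega, rfl, h4⟩
    · intro x hx
      simp only [Finset.coe_filter, hmemS, Set.mem_ofPred_eq, connSet] at hx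
      simp only [Finset.coe_range, Set.mem_Iio]
      omega
  rw [logCoeff, logSumEdges, list_sum_range]
  have h1 : ∀ x, ((Finset.Icc 1 ((AddMonoidHom.id ℕ) k)).filter fun j => j • ne x = k).card =
      ∑ j ∈ Finset.range k, if (j + 1) * ne x = k then 1 else 0 := by
    intro x
    rw [Finset.card_filter, Finset.sum_bij' (fun j _ => j - 1) (fun j _ => j + 1)]
    · simp only [Finset.mem_Icc, Finset.mem_range, AddMonoidHom.id_apply]; omega
    · simp only [Finset.mem_Icc, Finset.mem_range, AddMonoidHom.id_apply]; omega
    · simp only [Finset.mem_Icc]; omega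
    · simp
    · intro j hj
      simp only [Finset.mem_Icc] at hj
      simp only [smul_eq_mul, Nat.sub_add_cancel hj.1]
  simp only [h1, Finset.mul_sum]
  rw [Finset.sum_comm]
  refine Finset.sum_congr rfl fun j _ => ?_
  simp only [nsmul_eq_iff j.succ_pos]
  split_ifs with hd
  · rw [list_sum_range, hconn _ ((Nat.div_le_self _ _).trans hkd), Finset.card_filter, Finset.mul_sum]
    refine Finset.sum_congr rfl fun x _ => ?_
    by_cases hx : ne x = k / (j + 1)
    · rw [if_pos hx, if_pos ⟨hd, hx⟩, ← hx]
      rfl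
    · rw [if_neg hx, if_neg fun h => hx h.2, Nat.mul_zero, Nat.mul_zero]
  · refine Finset.sum_eq_zero fun x _ => ?_
    rw [if_neg fun h => hd h.1, Nat.mul_zero]

/-! ### Orbit sums -/

section OrbitSums

variable {K : Type*} [Field K] {n : ℕ}

theorem exists_relabel_iff (m m' : Multigraph (Fin n)) :
    (∃ σ : Equiv.Perm (Fin n), m.relabel σ = m') ↔ cls m = cls m' := by
  simp_rw [cls_eq_iff, relabel_eq_iff]

-- An orbit is an isomorphism class on a fixed vertex set, so orbit sums are indicator functions of
-- classes.
open Classical in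
theorem coeff_orbitSum (m m' : Multigraph (Fin n)) :
    coeff m' (orbitSum K m) = if cls m = cls m' then 1 else 0 := by
  have h : cls m = cls m' ↔ m' ∈ Finset.univ.image (fun σ : Equiv.Perm (Fin n) => m.relabel σ) := by
    rw [← exists_relabel_iff]
    simp
  rw [orbitSum, coeff_sum]
  simp only [coeff_monomial, h]
  rw [Finset.sum_ite_eq']

theorem orbitSum_congr {m m' : Multigraph (Fin n)} (h : cls m = cls m') :
    orbitSum K m = orbitSum K m' := by
  ext a
  rw [coeff_orbitSum, coeff_orbitSum, h]

theorem rename_monomial_pairEquiv (σ : Equiv.Perm (Fin n)) (m : Multigraph (Fin n)) (a : K) :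
    rename (pairEquiv σ) (monomial m a) = monomial (m.relabel σ) a := by
  rw [rename_monomial, relabel, Finsupp.equivMapDomain_eq_mapDomain]

theorem mem_Inv_iff (p : Pol K n) :
    p ∈ Inv K n ↔ ∀ (σ : Equiv.Perm (Fin n)) m, coeff (relabel σ m) p = coeff m p := by
  have key : ∀ (σ : Equiv.Perm (Fin n)) m, coeff (relabel σ m) (rename (pairEquiv σ) p) = coeff m p := by
    intro σ m
    rw [relabel, Finsupp.equivMapDomain_eq_mapDomain]
    exact coeff_rename_mapDomain _ (pairEquiv σ).injective _ _
  constructor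
  · intro h σ m
    conv_lhs => rw [← h σ]
    exact key σ m
  · intro h σ
    ext m
    have h1 := key σ (relabel σ.symm m)
    have h2 : relabel σ (relabel σ.symm m) = m := by
      rw [relabel_relabel, Equiv.symm_trans_self, relabel_refl]
    rw [h2] at h1
    rw [h1, h]

theorem coeff_eq_of_mem_Inv {p : Pol K n} (hp : p ∈ Inv K n) {m m' : Multigraph (Fin n)}
    (h : cls m = cls m') : coeff m p = coeff m' p := by
  obtain ⟨σ, rfl⟩ := (exists_relabel_iff m m').2 h
  exact ((mem_Inv_iff p).1 hp σ m).symm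

theorem orbitSum_mem_Inv (m : Multigraph (Fin n)) : orbitSum K m ∈ Inv K n := by
  rw [mem_Inv_iff]
  intro σ m'
  rw [coeff_orbitSum, coeff_orbitSum, cls_relabel]

theorem weight_one_eq_degree (m : Multigraph (Fin n)) :
    Finsupp.weight (1 : Pair (Fin n) → ℕ) m = m.degree := by
  rw [Finsupp.degree_eq_weight_one]
  rfl

theorem orbitSum_mem_homogeneous (m : Multigraph (Fin n)) :
    orbitSum K m ∈ homogeneousSubmodule (Pair (Fin n)) K m.degree := by
  classical
  rw [mem_homogeneousSubmodule]
  intro m' hm'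
  have h : cls m = cls m' := by
    by_contra h
    rw [coeff_orbitSum, if_neg h] at hm'
    exact hm' rfl
  have hd : m'.degree = m.degree := by rw [← ne_cls, ← ne_cls, h]
  rw [← hd, weight_one_eq_degree]

theorem Rec_le_Inv : Rec K n ≤ Inv K n := by
  refine Algebra.adjoin_le ?_
  rintro _ ⟨m, -, rfl⟩
  exact orbitSum_mem_Inv m

/-! ### Orbit sums as a basis of the invariants -/

/-- A labelled representative. -/
def rep (n : ℕ) (x : Cls) : Multigraph (Fin n) :=
  if h : nv x = n then (exists_rep_fin h).choose else 0

theorem cls_rep {x : Cls} (h : nv x = n) : cls (rep n x) = x := by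
  rw [rep, dif_pos h]
  exact (exists_rep_fin h).choose_spec

theorem nv_cls_fin (m : Multigraph (Fin n)) : nv (cls m) = n := (nv_cls m).trans (Fintype.card_fin n)

/-- Orbit sums of different classes have disjoint supports. The map `T` is only required not to lose
the coefficients at classes in `s`; this covers both the identity and, for simple classes, the
quotient by the squares. -/
theorem linearIndependent_orbitSum {M : Type*} [AddCommGroup M] [Module K M] (s : Set Cls)
    (hs : ∀ x ∈ s, nv x = n) (T : Pol K n →ₗ[K] M)
    (hT : ∀ p, T p = 0 → ∀ m, cls m ∈ s → coeff m p = 0) :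
    LinearIndependent K fun x : s => T (orbitSum K (rep n x)) := by
  classical
  rw [linearIndependent_iff']
  intro t a ha y hy
  have h0 : T (∑ x ∈ t, a x • orbitSum K (rep n (x : Cls))) = 0 := by
    rw [map_sum, ← ha]
    exact Finset.sum_congr rfl fun x _ => map_smul _ _ _
  have h1 := hT _ h0 (rep n y) (by rw [cls_rep (hs y y.2)]; exact y.2)
  rw [coeff_sum, Finset.sum_eq_single y] at h1
  · simpa [coeff_orbitSum] using h1
  · intro x _ hxy
    rw [coeff_smul, coeff_orbitSum, cls_rep (hs x x.2), cls_rep (hs y y.2),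
      if_neg fun h => hxy (Subtype.ext h), smul_zero]
  · exact fun h => absurd hy h

theorem ncard_le_finrank {M : Type*} [AddCommGroup M] [Module K M] (s : Set Cls) (hfin : s.Finite)
    (hs : ∀ x ∈ s, nv x = n) (T : Pol K n →ₗ[K] M)
    (hT : ∀ p, T p = 0 → ∀ m, cls m ∈ s → coeff m p = 0) (W : Submodule K M) [Module.Finite K W]
    (hW : ∀ x ∈ s, T (orbitSum K (rep n x)) ∈ W) : s.ncard ≤ Module.finrank K W := by
  have := hfin.fintype
  have hli : LinearIndependent K fun x : s => (⟨T (orbitSum K (rep n x)), hW x x.2⟩ : W) :=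
    LinearIndependent.of_comp W.subtype (linearIndependent_orbitSum s hs T hT)
  rw [← Nat.card_coe_set_eq, Nat.card_eq_fintype_card]
  exact hli.fintype_card_le_finrank

theorem finrank_span_image_le {ι M : Type*} [AddCommGroup M] [Module K M] {s : Set ι} (hs : s.Finite)
    (f : ι → M) : Module.finrank K (Submodule.span K (f '' s)) ≤ s.ncard := by
  have := (hs.image f).fintype
  refine (finrank_span_le_card _).trans ?_
  rw [← Set.ncard_eq_toFinset_card']
  exact Set.ncard_image_le hs

instance (A : Subalgebra K (Pol K n)) (d : ℕ) : Module.Finite K (component A d) := by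
  have : Module.Finite K (homogeneousSubmodule (Pair (Fin n)) K d) :=
    Module.Finite.iff_fg.2 (homogeneousSubmodule_fg _ _ d)
  exact Submodule.finiteDimensional_of_le inf_le_right

/-- The unlabelled multigraphs with `n` vertices and `d` edges. -/
def classSet (n d : ℕ) : Set Cls := {x | nv x = n ∧ ne x = d}

theorem finite_classSet (n d : ℕ) : (classSet n d).Finite :=
  (finite_nv_ne n d).subset fun _ h => ⟨h.1.le, h.2.le⟩

theorem orbitSum_rep_mem_homogeneous {x : Cls} (h : nv x = n) :
    orbitSum K (rep n x) ∈ homogeneousSubmodule (Pair (Fin n)) K (ne x) := by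
  have := orbitSum_mem_homogeneous (K := K) (rep n x)
  rwa [← ne_cls, cls_rep h] at this

theorem component_Inv_le_span (d : ℕ) :
    component (Inv K n) d ≤ Submodule.span K ((fun x => orbitSum K (rep n x)) '' classSet n d) := by
  classical
  rintro p ⟨hp, hd⟩
  have hp : p ∈ Inv K n := hp
  have hfin := finite_classSet n d
  have key : p = ∑ x ∈ hfin.toFinset, coeff (rep n x) p • orbitSum K (rep n x) := by
    ext m
    rw [coeff_sum]
    simp only [coeff_smul, coeff_orbitSum, smul_eq_mul, mul_ite, mul_one, MulZeroClass.mul_zero]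
    by_cases hm : m.degree = d
    · have hx : cls m ∈ classSet n d := ⟨nv_cls_fin m, (ne_cls m).trans hm⟩
      rw [Finset.sum_eq_single (cls m)]
      · rw [cls_rep hx.1, if_pos rfl]
        exact coeff_eq_of_mem_Inv hp (cls_rep hx.1).symm
      · intro x hx' hne
        rw [cls_rep (hfin.mem_toFinset.1 hx').1, if_neg hne]
      · intro h
        exact absurd (hfin.mem_toFinset.2 hx) h
    · rw [Finset.sum_eq_zero]
      · by_contra h
        refine hm ?_
        have := hd h
        rwa [weight_one_eq_degree] at this
      · intro x hx'
        have hx := hfin.mem_toFinset.1 hx'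
        rw [cls_rep hx.1, if_neg]
        intro h
        apply hm
        rw [← ne_cls, ← h]
        exact hx.2
  rw [key]
  exact Submodule.sum_mem _ fun x hx => Submodule.smul_mem _ _
    (Submodule.subset_span ⟨x, hfin.mem_toFinset.1 hx, rfl⟩)

theorem finrank_component_Inv (d : ℕ) :
    Module.finrank K (component (Inv K n) d) = (classSet n d).ncard := by
  refine le_antisymm ?_ ?_
  · have hfin := finite_classSet n d
    have : Module.Finite K (Submodule.span K ((fun x => orbitSum K (rep n x)) '' classSet n d)) :=
      FiniteDimensional.span_of_finite K (hfin.image _)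
    exact (Submodule.finrank_mono (component_Inv_le_span d)).trans (finrank_span_image_le hfin _)
  · refine ncard_le_finrank (classSet n d) (finite_classSet n d) (fun x hx => hx.1) LinearMap.id
      (fun p hp m _ => by rw [LinearMap.id_apply] at hp; rw [hp, coeff_zero]) _ fun x hx =>
      ⟨orbitSum_mem_Inv _, ?_⟩
    have := orbitSum_rep_mem_homogeneous (K := K) hx.1
    rwa [hx.2] at this

/-! ### Symmetrized monomials -/

/-- The sum of the monomials `x^(σ m)` over all permutations `σ`. -/
def symSum (K : Type*) [Field K] (m : Multigraph (Fin n)) : Pol K n :=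
  ∑ σ : Equiv.Perm (Fin n), monomial (m.relabel σ) 1

theorem symSum_relabel (τ : Equiv.Perm (Fin n)) (m : Multigraph (Fin n)) :
    symSum K (m.relabel τ) = symSum K m := by
  rw [symSum, symSum, ← Equiv.sum_comp (Equiv.mulRight τ) fun σ => monomial (relabel σ m) (1 : K)]
  refine Finset.sum_congr rfl fun σ _ => ?_
  rw [relabel_relabel]
  rfl

theorem symSum_congr {m m' : Multigraph (Fin n)} (h : cls m = cls m') : symSum K m = symSum K m' := by
  obtain ⟨σ, rfl⟩ := (exists_relabel_iff m m').2 h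
  exact (symSum_relabel σ m).symm

theorem relabel_add {V W : Type*} (σ : V ≃ W) (m m' : Multigraph V) :
    (m + m').relabel σ = m.relabel σ + m'.relabel σ := by
  refine ext_mul fun u v => ?_
  rw [Multigraph.mul_add, mul_relabel', mul_relabel', mul_relabel', Multigraph.mul_add]

/-- In the double sum over permutations the second one is replaced by its product with the first,
which then acts on the sum of both multigraphs. Summing over all permutations, not over orbits,
avoids counting stabilizers. -/
theorem symSum_mul_symSum (m m' : Multigraph (Fin n)) :
    symSum K m * symSum K m' = ∑ τ : Equiv.Perm (Fin n), symSum K (m + m'.relabel τ) := by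
  simp_rw [symSum]
  rw [Finset.sum_mul_sum, Finset.sum_comm (γ := Equiv.Perm (Fin n)) (s := Finset.univ)
    (f := fun τ σ => monomial (relabel σ (m + relabel τ m')) (1 : K))]
  refine Finset.sum_congr rfl fun σ _ => ?_
  rw [← Equiv.sum_comp (Equiv.mulLeft σ)]
  refine Finset.sum_congr rfl fun τ _ => ?_
  rw [monomial_mul, mul_one, relabel_add, relabel_relabel]
  rfl

/-- The factor is the order of the stabilizer of `m`, invertible in characteristic 0. -/
theorem exists_symSum_eq [CharZero K] (m : Multigraph (Fin n)) :
    ∃ a : K, a ≠ 0 ∧ symSum K m = a • orbitSum K m := by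
  classical
  refine ⟨coeff m (symSum K m), ?_, ?_⟩
  · rw [symSum, coeff_sum]
    simp only [coeff_monomial]
    rw [Finset.sum_boole, Nat.cast_ne_zero, ← Nat.pos_iff_ne_zero, Finset.card_pos]
    exact ⟨Equiv.refl _, by simpa using relabel_refl m⟩
  · have hinv : symSum K m ∈ Inv K n := by
      intro σ
      rw [symSum, map_sum]
      simp only [rename_monomial_pairEquiv, relabel_relabel]
      exact Equiv.sum_comp (Equiv.mulLeft σ) fun τ => monomial (relabel τ m) (1 : K)
    ext m'
    rw [coeff_smul, coeff_orbitSum]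
    split_ifs with h
    · rw [smul_eq_mul, mul_one, coeff_eq_of_mem_Inv hinv h]
    · rw [smul_zero, symSum, coeff_sum]
      refine Finset.sum_eq_zero fun σ _ => ?_
      rw [coeff_monomial, if_neg]
      rintro rfl
      exact h (cls_relabel σ m).symm

theorem orbitSum_mem_iff [CharZero K] (A : Subalgebra K (Pol K n)) (m : Multigraph (Fin n)) :
    orbitSum K m ∈ A ↔ symSum K m ∈ A := by
  obtain ⟨a, ha, h⟩ := exists_symSum_eq (K := K) m
  constructor
  · intro hm
    rw [h]
    exact A.smul_mem hm a
  · intro hm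
    have := A.smul_mem hm a⁻¹
    rwa [h, smul_smul, inv_mul_cancel₀ ha, one_smul] at this

end OrbitSums

/-! ### Connected generators of the algebra of reconstructible polynomials -/

section Generators

variable {n : ℕ}

open Classical in
/-- Up to isolated vertices, the class of `m` is `x`. -/
def Extends (m : Multigraph (Fin n)) (x : Cls) : Prop :=
  ∃ S : Set (Fin n), cls (m.restrict S) = x ∧ ∀ u v, m.mul u v ≠ 0 → u ∈ S ∧ v ∈ S

/-- An isomorphism between two subsets of `Fin n` extends to a permutation, and outside the subsets
there are no edges to respect. Hence `gen` does not depend on its choice. -/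
theorem Extends.cls_eq {m m' : Multigraph (Fin n)} {x : Cls} (h : Extends m x) (h' : Extends m' x) :
    cls m = cls m' := by
  classical
  obtain ⟨S, rfl, hS⟩ := h
  obtain ⟨S', hx, hS'⟩ := h'
  obtain ⟨τ, hτ⟩ := (cls_eq_iff _ _).1 hx.symm
  let τ' : {a // a ∈ S} ≃ {a // a ∈ S'} := τ
  refine (cls_eq_iff _ _).2 ⟨τ'.extendSubtype, fun u v => ?_⟩
  by_cases huv : u ∈ S ∧ v ∈ S
  · have := hτ ⟨u, huv.1⟩ ⟨v, huv.2⟩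
    rw [mul_restrict, mul_restrict] at this
    rw [Equiv.extendSubtype_apply_of_mem _ u huv.1, Equiv.extendSubtype_apply_of_mem _ v huv.2]
    exact this
  · have h1 : m.mul u v = 0 := by
      by_contra h
      exact huv (hS u v h)
    rw [h1]
    by_contra h
    have h2 := hS' _ _ h
    exact huv ⟨by_contra fun hu => Equiv.extendSubtype_not_mem τ' u hu h2.1,
      by_contra fun hv => Equiv.extendSubtype_not_mem τ' v hv h2.2⟩

theorem sum_eq_sum_set {V : Type} [Fintype V] (S : Set V) [Fintype S] (f : V → ℕ)
    (hf : ∀ v, f v ≠ 0 → v ∈ S) : ∑ v, f v = ∑ v : S, f v := by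
  classical
  rw [← Finset.sum_subset (Finset.subset_univ S.toFinset)]
  · exact Finset.sum_subtype _ (by simp) _
  · intro v _ hv
    by_contra h
    exact hv (Set.mem_toFinset.2 (hf v h))

theorem Extends.degree_eq {m : Multigraph (Fin n)} {x : Cls} (h : Extends m x) : m.degree = ne x := by
  classical
  obtain ⟨S, rfl, hS⟩ := h
  have h2 : 2 * m.degree = 2 * ne (cls (m.restrict S)) := by
    rw [ne_cls, two_mul_degree, two_mul_degree, sum_eq_sum_set S]
    · refine Finset.sum_congr rfl fun u _ => ?_
      rw [sum_eq_sum_set S _ fun v hv => (hS u v hv).2]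
      exact Finset.sum_congr rfl fun v _ => (mul_restrict m S u v).symm
    · intro u hu
      obtain ⟨v, -, hv⟩ := Finset.exists_ne_zero_of_sum_ne_zero hu
      exact (hS u v hv).1
  omega

theorem Extends.simple_of_isSimple {m : Multigraph (Fin n)} {x : Cls} (h : Extends m x)
    (hm : m.IsSimple) : Simple x := by
  classical
  obtain ⟨S, rfl, hS⟩ := h
  rw [simple_cls, isSimple_iff]
  intro u v
  rw [mul_restrict]
  exact (isSimple_iff m).1 hm _ _

/-- The orbit sum in `n` vertices of an unlabelled multigraph with at most `n` vertices. -/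
def gen (K : Type*) [Field K] (n : ℕ) (x : Cls) : Pol K n :=
  open Classical in
  if h : ∃ m : Multigraph (Fin n), Extends m x then orbitSum K h.choose else 0

variable {K : Type*} [Field K]

theorem Extends.orbitSum_eq_gen {m : Multigraph (Fin n)} {x : Cls} (h : Extends m x) :
    orbitSum K m = gen K n x := by
  have hex : ∃ m : Multigraph (Fin n), Extends m x := ⟨m, h⟩
  rw [gen, dif_pos hex]
  exact orbitSum_congr (h.cls_eq hex.choose_spec)

theorem gen_isHomogeneous (x : Cls) : (gen K n x).IsHomogeneous (ne x) := by
  classical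
  rw [gen]
  split_ifs with h
  · have := orbitSum_mem_homogeneous (K := K) h.choose
    rwa [h.choose_spec.degree_eq] at this
  · exact isHomogeneous_zero _ _ _

/-! ### Non-isolated vertices and splitting off components -/

open Classical in
/-- The vertices that are not isolated. -/
def vsupp (m : Multigraph (Fin n)) : Finset (Fin n) := Finset.univ.filter fun v => ¬ m.IsIsolated v

theorem mem_vsupp (m : Multigraph (Fin n)) (v : Fin n) : v ∈ vsupp m ↔ ∃ u, m.mul v u ≠ 0 := by
  simp [vsupp, isIsolated_iff]

theorem mem_vsupp_of_mul {m : Multigraph (Fin n)} {u v : Fin n} (h : m.mul u v ≠ 0) :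
    u ∈ vsupp m ∧ v ∈ vsupp m :=
  ⟨(mem_vsupp m u).2 ⟨v, h⟩, (mem_vsupp m v).2 ⟨u, by rwa [Multigraph.mul_comm]⟩⟩

theorem vsupp_add (m m' : Multigraph (Fin n)) : vsupp (m + m') = vsupp m ∪ vsupp m' := by
  ext v
  simp only [Finset.mem_union, mem_vsupp, Multigraph.mul_add]
  constructor
  · rintro ⟨u, hu⟩
    by_cases h : m.mul v u = 0
    · exact Or.inr ⟨u, by omega⟩
    · exact Or.inl ⟨u, h⟩
  · rintro (⟨u, hu⟩ | ⟨u, hu⟩)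
    · exact ⟨u, by omega⟩
    · exact ⟨u, by omega⟩

theorem vsupp_relabel (σ : Equiv.Perm (Fin n)) (m : Multigraph (Fin n)) :
    vsupp (m.relabel σ) = (vsupp m).map σ.toEmbedding := by
  ext v
  rw [Finset.mem_map_equiv, mem_vsupp, mem_vsupp]
  simp only [mul_relabel']
  exact ⟨fun ⟨u, hu⟩ => ⟨_, hu⟩, fun ⟨u, hu⟩ => ⟨σ u, by simpa using hu⟩⟩

theorem mul_perm_of_fixes {m : Multigraph (Fin n)} (π : Equiv.Perm (Fin n))
    (h : ∀ u ∈ vsupp m, π u = u) (u v : Fin n) : m.mul (π u) (π v) = m.mul u v := by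
  by_cases h1 : m.mul u v = 0
  · rw [h1]
    by_contra h2
    obtain ⟨h3, h4⟩ := mem_vsupp_of_mul h2
    rw [π.injective (h _ h3), π.injective (h _ h4)] at h2
    exact h2 h1
  · obtain ⟨h3, h4⟩ := mem_vsupp_of_mul h1
    rw [h u h3, h v h4]

/-- The identity on the support of `m` and `τ` on that of `m'` glue to an injective map, as both
placements are disjoint; it extends to a permutation. -/
theorem cls_add_relabel {m m' : Multigraph (Fin n)} (τ : Equiv.Perm (Fin n))
    (h : Disjoint (vsupp m) (vsupp m')) (hτ : Disjoint (vsupp m) (vsupp (m'.relabel τ))) :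
    cls (m + m'.relabel τ) = cls (m + m') := by
  classical
  let f : Fin n → Fin n := fun u => if u ∈ vsupp m then u else τ u
  have hτ' : ∀ u ∈ vsupp m', τ u ∉ vsupp m := by
    intro u hu hu'
    refine Finset.disjoint_left.1 hτ hu' ?_
    rw [vsupp_relabel]
    exact Finset.mem_map_of_mem _ hu
  have hinj : Set.InjOn f (vsupp m ∪ vsupp m' : Finset (Fin n)) := by
    intro u hu v hv huv
    simp only [Finset.coe_union, Set.mem_union, Finset.mem_coe] at hu hv
    by_cases h1 : u ∈ vsupp m <;> by_cases h2 : v ∈ vsupp m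
    · simpa [f, h1, h2] using huv
    · have : u = τ v := by simpa [f, h1, h2] using huv
      exact absurd (this ▸ h1) (hτ' v (hv.resolve_left h2))
    · have : τ u = v := by simpa [f, h1, h2] using huv
      exact absurd (this ▸ h2) (hτ' u (hu.resolve_left h1))
    · have : τ u = τ v := by simpa [f, h1, h2] using huv
      exact τ.injective this
  obtain ⟨g, hg⟩ := Finset.exists_equiv_extend_of_card_eq (t := (Finset.univ : Finset (Fin n)))
    (by simp) (Finset.subset_univ _) hinj
  let ρ : Equiv.Perm (Fin n) := g.trans (Equiv.subtypeUnivEquiv Finset.mem_univ)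
  have hρ1 : ∀ u ∈ vsupp m, ρ u = u := by
    intro u hu
    refine (hg u (Finset.mem_union_left _ hu)).trans ?_
    simp [f, hu]
  have hρ2 : ∀ u ∈ vsupp m', ρ u = τ u := by
    intro u hu
    refine (hg u (Finset.mem_union_right _ hu)).trans ?_
    simp [f, Finset.disjoint_right.1 h hu]
  refine ((cls_eq_iff _ _).2 ⟨ρ, fun u v => ?_⟩).symm
  rw [Multigraph.mul_add, Multigraph.mul_add, mul_perm_of_fixes ρ hρ1, mul_relabel']
  congr 1
  exact mul_perm_of_fixes (ρ.trans τ.symm) (fun u hu => by simp [hρ2 u hu]) u v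

open Classical in
/-- The edges of `m` inside `S`. -/
def part (m : Multigraph (Fin n)) (S : Set (Fin n)) : Multigraph (Fin n) :=
  ofMul (fun u v => if u ∈ S ∧ v ∈ S then m.mul u v else 0) fun u v => by
    simp only [Multigraph.mul_comm m u v, and_comm (a := u ∈ S)]

open Classical in
theorem mul_part (m : Multigraph (Fin n)) (S : Set (Fin n)) (u v : Fin n) :
    (part m S).mul u v = if u ∈ S ∧ v ∈ S then m.mul u v else 0 :=
  mul_ofMul _ _ (fun u => by rw [mul_self, ite_self]) u v

theorem vsupp_part_subset (m : Multigraph (Fin n)) (S : Set (Fin n)) : ∀ u ∈ vsupp (part m S), u ∈ S := by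
  intro u hu
  obtain ⟨v, hv⟩ := (mem_vsupp _ u).1 hu
  rw [mul_part] at hv
  by_contra h
  exact hv (if_neg fun h' => h h'.1)

theorem eq_zero_of_vsupp_eq_empty {m : Multigraph (Fin n)} (h : vsupp m = ∅) : m = 0 := by
  refine ext_mul fun u v => ?_
  rw [Multigraph.mul_zero]
  by_contra huv
  have := (mem_vsupp_of_mul huv).1
  rw [h] at this
  exact absurd this (Finset.notMem_empty u)

/-- Strong induction on the number of non-isolated vertices. If the edges form one component, `m`
gives a generator. Otherwise `m` is a component plus a rest; in the product of their symmetrizations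
the disjoint placements all yield `symSum K m`, while overlapping ones have smaller support and
belong to the algebra by induction. -/
theorem symSum_mem_adjoin [CharZero K] (m : Multigraph (Fin n)) (hm : (vsupp m).card < n) :
    symSum K m ∈ Algebra.adjoin K (gen K n '' connSet (fun _ => True) (n - 1)) := by
  classical
  set A := Algebra.adjoin K (gen K n '' connSet (fun _ => True) (n - 1)) with hA
  induction hs : (vsupp m).card using Nat.strong_induction_on generalizing m with
  | _ s ih =>
  have ih : ∀ m' : Multigraph (Fin n), (vsupp m').card < (vsupp m).card → symSum K m' ∈ A :=
    fun m' hm' => ih _ (hs ▸ hm') m' (hm'.trans hm) rfl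
  rcases (vsupp m).eq_empty_or_nonempty with h0 | ⟨u, hu⟩
  · rw [eq_zero_of_vsupp_eq_empty h0]
    refine A.sum_mem fun σ _ => ?_
    rw [(relabel_eq_iff σ 0 0).2 fun u v => by rw [Multigraph.mul_zero, Multigraph.mul_zero]]
    exact A.one_mem
  obtain ⟨v, huv⟩ := (mem_vsupp m u).1 hu
  -- The component is taken at a non-isolated vertex, so it has at least two vertices and the rest
  -- has strictly smaller support.
  set S := (m.underlying.connectedComponentMk u).supp with hS
  have hadj : ∀ a b, m.mul a b ≠ 0 → (a ∈ S ↔ b ∈ S) := by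
    intro a b hab
    have h1 : m.underlying.connectedComponentMk a = m.underlying.connectedComponentMk b :=
      SimpleGraph.ConnectedComponent.eq.2 ((underlying_adj m a b).2 hab).reachable
    rw [hS, SimpleGraph.ConnectedComponent.mem_supp_iff, SimpleGraph.ConnectedComponent.mem_supp_iff, h1]
  have huS : u ∈ S := rfl
  have hvS : v ∈ S := (hadj u v huv).1 huS
  have hadd : part m S + part m Sᶜ = m := by
    refine ext_mul fun a b => ?_
    rw [Multigraph.mul_add, mul_part, mul_part]
    by_cases hab : m.mul a b = 0
    · simp [hab]
    · by_cases ha : a ∈ S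
      · simp [ha, (hadj a b hab).1 ha]
      · have hb : b ∉ S := fun h => ha ((hadj a b hab).2 h)
        simp [ha, hb]
  have hdisj : Disjoint (vsupp (part m S)) (vsupp (part m Sᶜ)) :=
    Finset.disjoint_left.2 fun a ha hb => vsupp_part_subset m Sᶜ a hb (vsupp_part_subset m S a ha)
  have hcard : (vsupp m).card = (vsupp (part m S)).card + (vsupp (part m Sᶜ)).card := by
    conv_lhs => rw [← hadd]
    rw [vsupp_add, Finset.card_union_of_disjoint hdisj]
  have h1 : 0 < (vsupp (part m S)).card := by
    refine Finset.card_pos.2 ⟨u, (mem_vsupp _ _).2 ⟨v, ?_⟩⟩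
    rwa [mul_part, if_pos ⟨huS, hvS⟩]
  rcases (vsupp (part m Sᶜ)).eq_empty_or_nonempty with h2 | h2
  · have hm' : part m S = m := by
      conv_rhs => rw [← hadd, eq_zero_of_vsupp_eq_empty h2, add_zero]
    have hext : Extends m (cls (m.restrict S)) := by
      refine ⟨S, by convert rfl, fun a b hab => ?_⟩
      rw [← hm', mul_part] at hab
      by_contra h
      exact hab (if_neg h)
    have hSsub : ∀ a ∈ S, a ∈ vsupp m := by
      intro a ha
      obtain ⟨p⟩ := SimpleGraph.ConnectedComponent.eq.1
        ((SimpleGraph.ConnectedComponent.mem_supp_iff _ _).1 ha)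
      cases p with
      | nil => exact hu
      | cons hadj' _ => exact (mem_vsupp_of_mul ((underlying_adj m _ _).1 hadj')).1
    have hcardS : Fintype.card S ≤ (vsupp m).card := by
      rw [← Set.toFinset_card]
      exact Finset.card_le_card fun a ha => hSsub a (Set.mem_toFinset.1 ha)
    have hS2 : 1 < Fintype.card S := by
      refine Fintype.one_lt_card_iff.2 ⟨⟨u, huS⟩, ⟨v, hvS⟩, fun h => ?_⟩
      have huv' : u = v := congrArg Subtype.val h
      rw [huv'] at huv
      exact huv (mul_self m v)
    rw [← orbitSum_mem_iff, hext.orbitSum_eq_gen]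
    refine Algebra.subset_adjoin ⟨_, ⟨?_, ?_, ?_, trivial⟩, rfl⟩
    · rw [conn_cls, underlying_restrict]
      exact (m.underlying.connectedComponentMk u).connected_toSimpleGraph
    · rw [nv_cls]
      exact hS2
    · rw [nv_cls]
      omega
  · have h2 := Finset.card_pos.2 h2
    have hprod := A.mul_mem (ih (part m S) (by omega)) (ih (part m Sᶜ) (by omega))
    rw [symSum_mul_symSum, ← Finset.sum_filter_add_sum_filter_not Finset.univ
      (fun τ : Equiv.Perm (Fin n) => Disjoint (vsupp (part m S)) (vsupp (relabel τ (part m Sᶜ))))] at hprod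
    have hbad : ∑ τ ∈ Finset.univ.filter (fun τ : Equiv.Perm (Fin n) =>
        ¬ Disjoint (vsupp (part m S)) (vsupp (relabel τ (part m Sᶜ)))),
        symSum K (part m S + relabel τ (part m Sᶜ)) ∈ A := by
      refine A.sum_mem fun τ hτ => ih _ ?_
      have hτ := (Finset.mem_filter.1 hτ).2
      rw [vsupp_add, hcard]
      have h3 := Finset.card_union_add_card_inter (vsupp (part m S)) (vsupp (relabel τ (part m Sᶜ)))
      have h4 : 0 < (vsupp (part m S) ∩ vsupp (relabel τ (part m Sᶜ))).card :=
        Finset.card_pos.2 (Finset.not_disjoint_iff_nonempty_inter.1 hτ)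
      have h5 : (vsupp (relabel τ (part m Sᶜ))).card = (vsupp (part m Sᶜ)).card := by
        rw [vsupp_relabel, Finset.card_map]
      omega
    have hgood := A.sub_mem hprod hbad
    rw [add_sub_cancel_right, Finset.sum_congr rfl (g := fun _ => symSum K m), Finset.sum_const] at hgood
    · set N := (Finset.univ.filter (fun τ : Equiv.Perm (Fin n) =>
        Disjoint (vsupp (part m S)) (vsupp (relabel τ (part m Sᶜ))))).card with hN
      -- `N` counts the permutations that keep the pieces disjoint; the identity is one of them, so
      -- `N` can be divided out in characteristic 0.
      have hN0 : (N : K) ≠ 0 := by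
        rw [Nat.cast_ne_zero, ← Nat.pos_iff_ne_zero, hN, Finset.card_pos]
        refine ⟨Equiv.refl _, ?_⟩
        rw [Finset.mem_filter, relabel_refl]
        exact ⟨Finset.mem_univ _, hdisj⟩
      have := A.smul_mem hgood (N : K)⁻¹
      rwa [← Nat.cast_smul_eq_nsmul K, smul_smul, inv_mul_cancel₀ hN0, one_smul] at this
    · intro τ hτ
      refine symSum_congr ?_
      rw [cls_add_relabel τ hdisj (Finset.mem_filter.1 hτ).2, hadd]

theorem Rec_le_adjoin [CharZero K] :
    Rec K n ≤ Algebra.adjoin K (gen K n '' connSet (fun _ => True) (n - 1)) := by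
  refine Algebra.adjoin_le ?_
  rintro _ ⟨m, ⟨v, hv⟩, rfl⟩
  refine (orbitSum_mem_iff _ m).2 (symSum_mem_adjoin m ?_)
  have : vsupp m ⊂ Finset.univ := by
    refine Finset.ssubset_univ_iff.2 fun h => ?_
    have hv' : v ∈ vsupp m := h ▸ Finset.mem_univ v
    obtain ⟨u, hu⟩ := (mem_vsupp m v).1 hv'
    exact hu ((isIsolated_iff m v).1 hv u)
  simpa using Finset.card_lt_card this

theorem prod_gen_isHomogeneous (μ : Multiset Cls) :
    (μ.map (gen K n)).prod.IsHomogeneous (μ.map ne).sum := by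
  induction μ using Multiset.induction_on with
  | empty => simpa using isHomogeneous_one _ _
  | cons x μ ih =>
    rw [Multiset.map_cons, Multiset.prod_cons, Multiset.map_cons, Multiset.sum_cons]
    exact (gen_isHomogeneous x).mul ih

/-- The algebra is spanned by products of generators, each homogeneous of degree its number of
edges; projection to degree `d` keeps the products with `d` edges and kills the others. -/
theorem component_Rec_le_span [CharZero K] (d : ℕ) : component (Rec K n) d ≤
    Submodule.span K ((fun μ => (μ.map (gen K n)).prod) '' msSet (connSet (fun _ => True) (n - 1)) ne d) := by
  rintro p ⟨hp, hd⟩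
  have hp1 : p ∈ Subalgebra.toSubmodule (Algebra.adjoin K (gen K n '' connSet (fun _ => True) (n - 1))) :=
    Rec_le_adjoin hp
  rw [Algebra.adjoin_eq_span] at hp1
  have hp2 : homogeneousComponent d p = p := by
    rw [homogeneousComponent_of_mem hd, if_pos rfl]
  rw [← hp2]
  refine Submodule.span_induction (p := fun q _ => homogeneousComponent d q ∈ Submodule.span K _)
    ?_ ?_ ?_ ?_ hp1
  · intro q hq
    obtain ⟨l, hl, rfl⟩ := Submonoid.exists_multiset_of_mem_closure hq
    obtain ⟨μ, hμ, rfl⟩ : ∃ μ : Multiset Cls, (∀ x ∈ μ, x ∈ connSet (fun _ => True) (n - 1)) ∧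
        μ.map (gen K n) = l := by
      clear hq
      induction l using Multiset.induction_on with
      | empty => exact ⟨0, by simp, by simp⟩
      | cons a l ih =>
        obtain ⟨μ, hμ, rfl⟩ := ih fun y hy => hl y (Multiset.mem_cons_of_mem hy)
        obtain ⟨x, hx, rfl⟩ := hl a (Multiset.mem_cons_self a _)
        exact ⟨x ::ₘ μ, by simpa using ⟨hx, hμ⟩, by simp⟩
    rw [homogeneousComponent_of_mem (prod_gen_isHomogeneous μ)]
    split_ifs with h
    · exact Submodule.subset_span ⟨μ, ⟨hμ, h.symm⟩, rfl⟩
    · exact Submodule.zero_mem _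
  · rw [map_zero]
    exact Submodule.zero_mem _
  · intro a b _ _ ha hb
    rw [map_add]
    exact Submodule.add_mem _ ha hb
  · intro c a _ ha
    rw [map_smul]
    exact Submodule.smul_mem _ c ha

theorem finrank_component_Rec_le [CharZero K] (d : ℕ) :
    Module.finrank K (component (Rec K n) d) ≤ multisetNum (fun _ => True) (n - 1) d := by
  have hfin := finite_msSet_connSet (fun _ => True) (n - 1) d
  have : Module.Finite K (Submodule.span K ((fun μ => (μ.map (gen K n)).prod) ''
      msSet (connSet (fun _ => True) (n - 1)) ne d)) := FiniteDimensional.span_of_finite K (hfin.image _)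
  exact (Submodule.finrank_mono (component_Rec_le_span d)).trans (finrank_span_image_le hfin _)

/-! ### Simple graphs -/

/-- The ideal is monomial, so each monomial occurring in `p` is divisible by the square of a
variable. -/
theorem coeff_eq_zero_of_mem_squareIdeal {p : Pol K n} (hp : p ∈ squareIdeal K n)
    {m : Multigraph (Fin n)} (hm : m.IsSimple) : coeff m p = 0 := by
  have h : squareIdeal K n = Ideal.span ((fun s => monomial s (1 : K)) ''
      Set.range fun e : Pair (Fin n) => Finsupp.single e 2) := by
    rw [squareIdeal, ← Set.range_comp]
    congr 2
    funext e
    exact X_pow_eq_monomial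
  rw [h, mem_ideal_span_monomial_image] at hp
  by_contra h0
  obtain ⟨_, ⟨e, rfl⟩, hle⟩ := hp m (mem_support_iff.2 h0)
  have := hle e
  rw [Finsupp.single_eq_same] at this
  have := hm e
  omega

theorem orbitSum_mem_squareIdeal {m : Multigraph (Fin n)} (hm : ¬ m.IsSimple) :
    orbitSum K m ∈ squareIdeal K n := by
  refine Ideal.sum_mem _ fun m' hm' => ?_
  obtain ⟨σ, -, rfl⟩ := Finset.mem_image.1 hm'
  have h1 : ¬ (relabel σ m).IsSimple := by rwa [isSimple_relabel]
  simp only [IsSimple, not_forall, not_le] at h1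
  obtain ⟨e, he⟩ := h1
  have h2 : monomial (relabel σ m) (1 : K) =
      monomial (relabel σ m - Finsupp.single e 2) 1 * X e ^ 2 := by
    rw [X_pow_eq_monomial, monomial_mul, mul_one, tsub_add_cancel_of_le (Finsupp.single_le_iff.2 he)]
  rw [h2]
  exact Ideal.mul_mem_left _ _ (Ideal.subset_span ⟨e, rfl⟩)

theorem gen_mem_squareIdeal {x : Cls} (hx : ¬ Simple x) : gen K n x ∈ squareIdeal K n := by
  rw [gen]
  split_ifs with h
  · exact orbitSum_mem_squareIdeal fun h' => hx (h.choose_spec.simple_of_isSimple h')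
  · exact Ideal.zero_mem _

/-- A product with a non-simple factor lies in the ideal of squares, so only multisets of simple
connected classes contribute to the image. -/
theorem finrank_simpleComponent_Rec_le [CharZero K] (d : ℕ) :
    Module.finrank K (simpleComponent (Rec K n) d) ≤ multisetNum Simple (n - 1) d := by
  have hfin := finite_msSet_connSet Simple (n - 1) d
  set T := (Ideal.Quotient.mkₐ K (squareIdeal K n)).toLinearMap with hT
  have hle : simpleComponent (Rec K n) d ≤ Submodule.span K
      ((fun μ => T (μ.map (gen K n)).prod) '' msSet (connSet Simple (n - 1)) ne d) := by
    refine (Submodule.map_mono (component_Rec_le_span d)).trans ?_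
    rw [Submodule.map_span, Submodule.span_le]
    rintro _ ⟨_, ⟨μ, ⟨h1, h2⟩, rfl⟩, rfl⟩
    by_cases hs : ∀ x ∈ μ, Simple x
    · exact Submodule.subset_span ⟨μ, ⟨fun x hx => ⟨(h1 x hx).1, (h1 x hx).2.1, (h1 x hx).2.2.1, hs x hx⟩, h2⟩, rfl⟩
    · push Not at hs
      obtain ⟨x, hx, hxs⟩ := hs
      have h0 : (μ.map (gen K n)).prod ∈ squareIdeal K n :=
        Ideal.mem_of_dvd _ (Multiset.dvd_prod (Multiset.mem_map_of_mem _ hx)) (gen_mem_squareIdeal hxs)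
      have h0' : T (μ.map (gen K n)).prod = 0 := Ideal.Quotient.eq_zero_iff_mem.2 h0
      simp only [SetLike.mem_coe]
      change T (μ.map (gen K n)).prod ∈ _
      rw [h0']
      exact Submodule.zero_mem _
  have : Module.Finite K (Submodule.span K ((fun μ => T (μ.map (gen K n)).prod) ''
      msSet (connSet Simple (n - 1)) ne d)) := FiniteDimensional.span_of_finite K (hfin.image _)
  exact (Submodule.finrank_mono hle).trans (finrank_span_image_le hfin _)

instance (A : Subalgebra K (Pol K n)) (d : ℕ) : Module.Finite K (simpleComponent A d) :=
  inferInstanceAs (Module.Finite K ((component A d).map _))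

/-- If the simple orbit sums belong to `A`, the image of `A` modulo squares is large. -/
theorem classNum_simple_le_finrank (A : Subalgebra K (Pol K n)) (d : ℕ)
    (hA : ∀ m : Multigraph (Fin n), m.IsSimple → m.degree = d → orbitSum K m ∈ A) :
    classNum Simple n d ≤ Module.finrank K (simpleComponent A d) := by
  refine ncard_le_finrank (n := n) {x | nv x = n ∧ ne x = d ∧ Simple x}
    ((finite_classSet n d).subset fun x h => ⟨h.1, h.2.1⟩) (fun x h => h.1)
    (Ideal.Quotient.mkₐ K (squareIdeal K n)).toLinearMap ?_ _ ?_
  · intro p hp m hm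
    exact coeff_eq_zero_of_mem_squareIdeal (Ideal.Quotient.eq_zero_iff_mem.1 hp) ((simple_cls m).1 hm.2.2)
  · rintro x ⟨h1, h2, h3⟩
    have hr := orbitSum_rep_mem_homogeneous (K := K) h1
    rw [h2] at hr
    refine Submodule.mem_map_of_mem ⟨hA _ ?_ ?_, hr⟩
    · rw [← simple_cls, cls_rep h1]
      exact h3
    · rw [← ne_cls, cls_rep h1, h2]

end Generators

/-! ### Numerical comparison -/

/-- Entry of a table. -/
def entry (T : List (List ℕ)) (n e : ℕ) : ℕ := (T.getD n []).getD e 0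

/-- Test of the Euler transform: the table `C` of numbers of connected classes explains the table
`H` of numbers of classes (rows of `H` are listed backwards). -/
def eulerCheck (H C : List (List ℕ)) (N D : ℕ) : Bool :=
  (List.range N).all fun n => (List.range (D + 1)).all fun e =>
    (n + 1) * entry H (n + 1) (D - e) = ((List.range (n + 2)).map fun k =>
      ((List.range (e + 1)).map fun l =>
        logSum (entry C) k l * entry H (n + 1 - k) (D - (e - l))).sum).sum

/-- The check certifies `C` as the table of connected numbers for 1 to `N` vertices; the edge-graded
Euler transform then evaluates the count, whose value at `D` comes first in the reversed list. -/
theorem multisetNum_eq {P : Cls → Prop} (hP : Componentwise P) (H C : List (List ℕ)) (N D : ℕ)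
    (hN : 0 < N) (hH : ∀ n ≤ N, ∀ e ≤ D, entry H n (D - e) = classNum P n e)
    (hcheck : eulerCheck H C N D = true) :
    multisetNum P N D =
      (eulerRev ((List.range D).map fun k => logSumEdges (entry C) N (k + 1)) D).headD 0 := by
  have hc : ∀ n ≤ N, 0 < n → ∀ e ≤ D, connNum P n e = entry C n e := by
    refine connNum_eq_of_recursion hP N D (entry C) fun n hn hn0 e he => ?_
    obtain ⟨n, rfl⟩ : ∃ m, n = m + 1 := ⟨n - 1, by omega⟩
    rw [eulerCheck, List.all_eq_true] at hcheck
    have h1 := hcheck n (List.mem_range.2 hn)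
    rw [List.all_eq_true] at h1
    have h2 := h1 e (List.mem_range.2 (Nat.lt_succ_of_le he))
    rw [decide_eq_true_iff, hH _ hn _ he, list_sum_range] at h2
    rw [h2]
    refine Finset.sum_congr rfl fun k hk => ?_
    rw [list_sum_range]
    refine Finset.sum_congr rfl fun l hl => ?_
    rw [hH _ (by omega) _ (by omega)]
  have hs : ((List.range D).map fun k => logSumEdges (entry C) N (k + 1)) =
      (List.range D).map fun k => logSumEdges (connNum P) N (k + 1) := by
    refine List.map_congr_left fun k hk => ?_
    have hk := List.mem_range.1 hk
    rw [logSumEdges, logSumEdges]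
    congr 1
    refine List.map_congr_left fun j _ => ?_
    congr 3
    refine List.map_congr_left fun i hi => ?_
    have hi := List.mem_range.1 hi
    rw [hc _ (by omega) (by omega) _ ((Nat.div_le_self _ _).trans hk)]
  rw [hs, eulerRev_eq (multisetNum P N) _ (multisetNum_zero P N) (mul_multisetNum P N) D D le_rfl,
    List.range_succ_eq_map]
  simp

/-- Rows are listed backwards, hence the index `D - e`. The row of zero vertices is given
separately, because the enumeration of cycle types assumes a vertex. -/
theorem entry_eq_classNum {P : Cls → Prop} (hP : Componentwise P) (H : List (List ℕ)) (N D : ℕ)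
    (row : ℕ → List ℕ) (hrow : ∀ n, 0 < n → row n = (List.range (D + 1)).map fun i => classNum P n (D - i))
    (hH : H = (List.replicate D 0 ++ [1]) :: (List.range N).map fun n => row (n + 1)) :
    ∀ n ≤ N, ∀ e ≤ D, entry H n (D - e) = classNum P n e := by
  intro n hn e he
  subst hH
  rcases Nat.eq_zero_or_pos n with rfl | hn0
  · rw [classNum_zero hP, entry, List.getD_cons_zero]
    split_ifs with h
    · simp [h]
    · rw [List.getD_append _ _ _ _ (by simp; omega)]
      simp
  · obtain ⟨n, rfl⟩ : ∃ m, n = m + 1 := ⟨n - 1, by omega⟩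
    have hget : ((List.range N).map fun n => row (n + 1)).getD n [] = row (n + 1) := by
      rw [List.getD_eq_getElem _ _ (by simpa using hn), List.getElem_map, List.getElem_range]
    rw [entry, List.getD_cons_succ, hget, hrow _ n.succ_pos, List.getD_eq_getElem _ _ (by simp), List.getElem_map,
      List.getElem_range, Nat.sub_sub_self he]

/-- The numbers of unlabelled multigraphs with `n` vertices (for `n ≤ 11`) and `18, …, 0` edges. -/
def multTable : List (List ℕ) := [
    [0, 0, 0, 0, 0, 0, 0, 0, 0, 0, 0, 0, 0, 0, 0, 0, 0, 0, 1],
    [0, 0, 0, 0, 0, 0, 0, 0, 0, 0, 0, 0, 0, 0, 0, 0, 0, 0, 1],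
    [1, 1, 1, 1, 1, 1, 1, 1, 1, 1, 1, 1, 1, 1, 1, 1, 1, 1, 1],
    [37, 33, 30, 27, 24, 21, 19, 16, 14, 12, 10, 8, 7, 5, 4, 3, 2, 1, 1],
    [1550, 1221, 956, 738, 562, 420, 313, 224, 160, 111, 75, 48, 32, 18, 11, 6, 3, 1, 1],
    [41550, 27944, 18485, 11986, 7620, 4730, 2874, 1691, 974, 539, 291, 149, 76, 35, 17, 7, 3, 1,
    1],
    [696750, 396428, 220546, 119745, 63363, 32604, 16310, 7895, 3711, 1684, 741, 313, 132, 52, 21,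
    8, 3, 1, 1],
    [7180856, 3455129, 1619321, 738090, 326792, 140340, 58464, 23574, 9234, 3510, 1303, 471, 173,
    60, 22, 8, 3, 1, 1],
    [47170674, 19311709, 7685972, 2970964, 1114890, 406091, 143761, 49505, 16677, 5509, 1806, 588,
    197, 64, 23, 8, 3, 1, 1],
    [206906004, 72797692, 24900625, 8280672, 2679422, 844911, 260526, 78845, 23615, 7042, 2121,
    645, 206, 65, 23, 8, 3, 1, 1],
    [638081578, 195533148, 58389489, 17015285, 4851060, 1358128, 375543, 103220, 28494, 7964,
    2283, 671, 210, 66, 23, 8, 3, 1, 1],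
    [1457002920, 395243518, 104991688, 27396123, 7053679, 1802421, 460621, 118662, 31153, 8392,
    2347, 680, 211, 66, 23, 8, 3, 1, 1]]

/-- The numbers of connected unlabelled multigraphs with `n` vertices (for `n ≤ 10`) and
`0, …, 18` edges. -/
def multConnTable : List (List ℕ) := [
    [0, 0, 0, 0, 0, 0, 0, 0, 0, 0, 0, 0, 0, 0, 0, 0, 0, 0, 0],
    [1, 0, 0, 0, 0, 0, 0, 0, 0, 0, 0, 0, 0, 0, 0, 0, 0, 0, 0],
    [0, 1, 1, 1, 1, 1, 1, 1, 1, 1, 1, 1, 1, 1, 1, 1, 1, 1, 1],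
    [0, 0, 1, 2, 3, 4, 6, 7, 9, 11, 13, 15, 18, 20, 23, 26, 29, 32, 36],
    [0, 0, 0, 2, 5, 11, 22, 37, 61, 95, 141, 203, 288, 393, 531, 704, 918, 1180, 1504],
    [0, 0, 0, 0, 3, 11, 34, 85, 193, 396, 771, 1411, 2490, 4221, 6949, 11116, 17371, 26536, 39781],
    [0, 0, 0, 0, 0, 6, 29, 110, 348, 969, 2445, 5746, 12736, 26843, 54256, 105669, 199170, 364565,
    649956],
    [0, 0, 0, 0, 0, 0, 11, 70, 339, 1318, 4457, 13572, 38201, 100622, 251078, 597554, 1364722,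
    3004250, 6398915],
    [0, 0, 0, 0, 0, 0, 0, 23, 185, 1067, 4940, 19753, 70930, 234096, 721332, 2097462, 5801091,
    15351493, 39054916],
    [0, 0, 0, 0, 0, 0, 0, 0, 47, 479, 3294, 17927, 83732, 349156, 1333992, 4743843, 15881206,
    50455727, 153070783],
    [0, 0, 0, 0, 0, 0, 0, 0, 0, 106, 1279, 10218, 64182, 344070, 1643022, 7169559, 29067481,
    110754990, 399907209]]

/-- The numbers of unlabelled simple graphs with `n` vertices (for `n ≤ 13`) and `17, …, 0` edges. -/
def simpleTable : List (List ℕ) := [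
    [0, 0, 0, 0, 0, 0, 0, 0, 0, 0, 0, 0, 0, 0, 0, 0, 0, 1],
    [0, 0, 0, 0, 0, 0, 0, 0, 0, 0, 0, 0, 0, 0, 0, 0, 0, 1],
    [0, 0, 0, 0, 0, 0, 0, 0, 0, 0, 0, 0, 0, 0, 0, 0, 1, 1],
    [0, 0, 0, 0, 0, 0, 0, 0, 0, 0, 0, 0, 0, 0, 1, 1, 1, 1],
    [0, 0, 0, 0, 0, 0, 0, 0, 0, 0, 0, 1, 1, 2, 3, 2, 1, 1],
    [0, 0, 0, 0, 0, 0, 0, 1, 1, 2, 4, 6, 6, 6, 4, 2, 1, 1],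
    [0, 0, 1, 1, 2, 5, 9, 15, 21, 24, 24, 21, 15, 9, 5, 2, 1, 1],
    [10, 21, 41, 65, 97, 131, 148, 148, 131, 97, 65, 41, 21, 10, 5, 2, 1, 1],
    [980, 1312, 1557, 1646, 1557, 1312, 980, 663, 402, 221, 115, 56, 24, 11, 5, 2, 1, 1],
    [32403, 27987, 21933, 15615, 10120, 5995, 3252, 1637, 771, 345, 148, 63, 25, 11, 5, 2, 1, 1],
    [395166, 241577, 136433, 71318, 34663, 15772, 6759, 2769, 1103, 428, 165, 66, 26, 11, 5, 2, 1,
    1],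
    [2295898, 1069890, 467807, 192788, 75415, 28259, 10250, 3664, 1305, 467, 172, 67, 26, 11, 5,
    2, 1, 1],
    [7739601, 2911086, 1043774, 359307, 119890, 39243, 12763, 4191, 1405, 485, 175, 68, 26, 11, 5,
    2, 1, 1],
    [17422984, 5546619, 1711908, 517121, 154658, 46415, 14140, 4435, 1446, 492, 176, 68, 26, 11,
    5, 2, 1, 1]]

/-- The numbers of connected unlabelled simple graphs with `n` vertices (for `n ≤ 12`) and
`0, …, 17` edges. -/
def simpleConnTable : List (List ℕ) := [
    [0, 0, 0, 0, 0, 0, 0, 0, 0, 0, 0, 0, 0, 0, 0, 0, 0, 0],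
    [1, 0, 0, 0, 0, 0, 0, 0, 0, 0, 0, 0, 0, 0, 0, 0, 0, 0],
    [0, 1, 0, 0, 0, 0, 0, 0, 0, 0, 0, 0, 0, 0, 0, 0, 0, 0],
    [0, 0, 1, 1, 0, 0, 0, 0, 0, 0, 0, 0, 0, 0, 0, 0, 0, 0],
    [0, 0, 0, 2, 2, 1, 1, 0, 0, 0, 0, 0, 0, 0, 0, 0, 0, 0],
    [0, 0, 0, 0, 3, 5, 5, 4, 2, 1, 1, 0, 0, 0, 0, 0, 0, 0],
    [0, 0, 0, 0, 0, 6, 13, 19, 22, 20, 14, 9, 5, 2, 1, 1, 0, 0],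
    [0, 0, 0, 0, 0, 0, 11, 33, 67, 107, 132, 138, 126, 95, 64, 40, 21, 10],
    [0, 0, 0, 0, 0, 0, 0, 23, 89, 236, 486, 814, 1169, 1454, 1579, 1515, 1290, 970],
    [0, 0, 0, 0, 0, 0, 0, 0, 47, 240, 797, 2075, 4495, 8404, 13855, 20303, 26631, 31400],
    [0, 0, 0, 0, 0, 0, 0, 0, 0, 106, 657, 2678, 8548, 22950, 53863, 112618, 211866, 361342],
    [0, 0, 0, 0, 0, 0, 0, 0, 0, 0, 235, 1806, 8833, 33851, 109844, 313670, 803905, 1870168],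
    [0, 0, 0, 0, 0, 0, 0, 0, 0, 0, 0, 551, 5026, 28908, 130365, 499888, 1694642, 5184582]]

/-- The Burnside sums over all cycle types, evaluated by the kernel; later checks read the literal
table instead. -/
theorem multTable_eq : multTable = (List.replicate 18 0 ++ [1]) ::
    (List.range 11).map fun n => classRow (multRow (n + 1) 18) (n + 1) 18 := by
  decide +kernel

theorem simpleTable_eq : simpleTable = (List.replicate 17 0 ++ [1]) ::
    (List.range 13).map fun n => classRow (simpleRow (n + 1) 17) (n + 1) 17 := by
  decide +kernel

theorem eulerCheck_mult : eulerCheck multTable multConnTable 10 18 = true := by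
  decide +kernel

theorem eulerCheck_simple : eulerCheck simpleTable simpleConnTable 12 17 = true := by
  decide +kernel

theorem multisetNum_lt_classNum_mult :
    multisetNum (fun _ => True) 10 18 < classNum (fun _ => True) 11 18 := by
  have hH := entry_eq_classNum componentwise_true multTable 11 18 _
    (fun n hn => classRow_multRow n 18 hn) multTable_eq
  rw [multisetNum_eq componentwise_true multTable multConnTable 10 18 (by norm_num)
    (fun n hn => hH n (by omega)) eulerCheck_mult, ← hH 11 le_rfl 18 le_rfl]
  decide +kernel

theorem multisetNum_lt_classNum_simple : multisetNum Simple 12 17 < classNum Simple 13 17 := by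
  have hH := entry_eq_classNum componentwise_simple simpleTable 13 17 _
    (fun n hn => classRow_simpleRow n 17 hn) simpleTable_eq
  rw [multisetNum_eq componentwise_simple simpleTable simpleConnTable 12 17 (by norm_num)
    (fun n hn => hH n (by omega)) eulerCheck_simple, ← hH 13 le_rfl 17 le_rfl]
  decide +kernel

/-! ### The numbers of unlabelled multigraphs -/

theorem mk_image_eq (S : Set (Σ N : ℕ, Multigraph (Fin N))) :
    Quotient.mk isoSetoid '' S = {x | ∃ g ∈ S, cls g.2 = x} := by
  ext x
  simp only [Set.mem_image, Set.mem_ofPred_eq, cls_fin]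

theorem hCount_eq (n d : ℕ) : hCount n d = (classSet n d).ncard := by
  rw [hCount, classCount, mk_image_eq]
  congr 1
  ext x
  constructor
  · rintro ⟨⟨N, m⟩, ⟨h1, h2⟩, rfl⟩
    exact ⟨(nv_cls_fin m).trans h1, (ne_cls m).trans h2⟩
  · rintro ⟨h1, h2⟩
    obtain ⟨m, rfl⟩ := exists_rep_fin h1
    exact ⟨⟨n, m⟩, ⟨rfl, (ne_cls m).symm.trans h2⟩, rfl⟩

theorem classNum_true_eq (n d : ℕ) : classNum (fun _ => True) n d = (classSet n d).ncard := by
  simp [classNum, classSet]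

theorem forall_not_isIsolated_iff {N : ℕ} (m : Multigraph (Fin N)) :
    (∀ v, ¬ m.IsIsolated v) ↔ ∀ c : m.underlying.ConnectedComponent, 2 ≤ c.supp.ncard := by
  constructor
  · intro h c
    induction c using SimpleGraph.ConnectedComponent.ind with
    | _ v =>
    obtain ⟨u, hu⟩ := not_forall.1 (mt (isIsolated_iff m v).2 (h v))
    have hadj := (underlying_adj m v u).2 hu
    refine (Set.one_lt_ncard_iff).2 ⟨v, u, rfl, ?_, hadj.ne⟩
    exact SimpleGraph.ConnectedComponent.eq.2 hadj.reachable.symm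
  · intro h v hv
    obtain ⟨a, ha, hav⟩ := Set.exists_ne_of_one_lt_ncard (h (m.underlying.connectedComponentMk v)) v
    obtain ⟨p⟩ := SimpleGraph.ConnectedComponent.eq.1
      ((SimpleGraph.ConnectedComponent.mem_supp_iff _ _).1 ha).symm
    cases p with
    | nil => exact hav rfl
    | cons hadj _ => exact (underlying_adj m _ _).1 hadj ((isIsolated_iff m v).1 hv _)

theorem forall_mem_comps_nv {N : ℕ} (m : Multigraph (Fin N)) (Q : ℕ → Prop) :
    (∀ y ∈ comps m, Q (nv y)) ↔ ∀ c : m.underlying.ConnectedComponent, Q c.supp.ncard := by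
  classical
  have h : ∀ (c : m.underlying.ConnectedComponent) (i : Fintype c.supp), nv (@cls _ i (m.restrict c.supp)) = c.supp.ncard := by
    intro c i
    rw [nv_cls, ← Nat.card_eq_fintype_card, Nat.card_coe_set_eq]
  simp only [comps, Multiset.mem_map, Finset.mem_val, Finset.mem_univ, true_and, forall_exists_index,
    forall_apply_eq_imp_iff]
  exact forall_congr' fun c => iff_of_eq (congrArg Q (h c _))

/-- Having no isolated vertex means that all components have at least two vertices, so the
multigraphs counted by `fCount` are the multisets of classes in `connSet`. -/
theorem fCount_eq (n d : ℕ) (hn : 0 < n) : fCount n d = multisetNum (fun _ => True) (n - 1) d := by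
  have h := ncard_eq_msSet ne d (fun y => 2 ≤ nv y ∧ nv y ≤ n - 1 ∧ True) sum_ne_components
  rw [multisetNum, connSet, ← h, fCount, classCount, mk_image_eq]
  congr 1
  have key : ∀ {N : ℕ} (m : Multigraph (Fin N)), ((∀ v, ¬ m.IsIsolated v) ∧
      ∀ c : m.underlying.ConnectedComponent, c.supp.ncard < n) ↔
      ∀ y ∈ components (cls m), 2 ≤ nv y ∧ nv y ≤ n - 1 ∧ True := by
    intro N m
    rw [components_cls, forall_mem_comps_nv m fun k => 2 ≤ k ∧ k ≤ n - 1 ∧ True,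
      forall_not_isIsolated_iff, ← forall_and]
    refine forall_congr' fun c => ?_
    rw [and_true]
    refine and_congr_right fun _ => ?_
    omega
  ext x
  constructor
  · rintro ⟨⟨N, m⟩, ⟨h1, h2⟩, rfl⟩
    exact ⟨(ne_cls m).trans h1, (key m).1 h2⟩
  · rintro ⟨h1, h2⟩
    obtain ⟨N, m, rfl⟩ := exists_rep x
    exact ⟨⟨N, m⟩, ⟨(ne_cls m).symm.trans h1, (key m).2 h2⟩, rfl⟩

/-- The classes are divided into reconstructible ones, whose orbit sums are independent in `Rec` and
so number at most its dimension, and the others. -/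
theorem hCount_le {K : Type*} [Field K] (n d : ℕ) :
    hCount n d ≤ Module.finrank K (component (Rec K n) d) + classCount
      {g | ∃ m : Multigraph (Fin n), g = ⟨n, m⟩ ∧ m.degree = d ∧ ¬ IsAlgRec K m} := by
  have hfin := finite_classSet n d
  have h1 : (classSet n d ∩ {x | IsAlgRec K (rep n x)}).ncard ≤
      Module.finrank K (component (Rec K n) d) := by
    refine ncard_le_finrank _ (hfin.subset Set.inter_subset_left) (fun x hx => hx.1.1) LinearMap.id
      (fun p hp m _ => by rw [LinearMap.id_apply] at hp; rw [hp, coeff_zero]) _ fun x hx => ⟨hx.2, ?_⟩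
    have := orbitSum_rep_mem_homogeneous (K := K) hx.1.1
    rwa [hx.1.2] at this
  have h2 : (classSet n d \ {x | IsAlgRec K (rep n x)}).ncard ≤ classCount
      {g | ∃ m : Multigraph (Fin n), g = ⟨n, m⟩ ∧ m.degree = d ∧ ¬ IsAlgRec K m} := by
    rw [classCount, mk_image_eq]
    refine Set.ncard_le_ncard ?_ (hfin.subset ?_)
    · rintro x ⟨hx, hx'⟩
      refine ⟨⟨n, rep n x⟩, ⟨rep n x, rfl, ?_, hx'⟩, cls_rep hx.1⟩
      rw [← ne_cls, cls_rep hx.1, hx.2]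
    · rintro x ⟨_, ⟨m, rfl, hm, -⟩, rfl⟩
      exact ⟨nv_cls_fin m, (ne_cls m).trans hm⟩
  rw [hCount_eq, ← Set.ncard_inter_add_ncard_sdiff_eq_ncard (classSet n d) {x | IsAlgRec K (rep n x)} hfin]
  exact Nat.add_le_add h1 h2

end GraphRec
end

/-! ### Conclusion from the bounds and the numerical comparisons -/

theorem mainTheorem1 (K : Type*) [Field K] [CharZero K] :
    Module.finrank K (GraphRec.component (GraphRec.Rec K 11) 18) ≤ GraphRec.fCount 11 18 ∧
    GraphRec.fCount 11 18 < Module.finrank K (GraphRec.component (GraphRec.Inv K 11) 18) ∧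
    Module.finrank K (GraphRec.component (GraphRec.Inv K 11) 18) = GraphRec.hCount 11 18 ∧
    GraphRec.Rec K 11 < GraphRec.Inv K 11 ∧
    (∃ m : GraphRec.Multigraph (Fin 11), m.degree = 18 ∧ ¬ GraphRec.IsAlgRec K m) ∧
    GraphRec.hCount 11 18 ≤ GraphRec.fCount 11 18 + GraphRec.classCount
      {g | ∃ m : GraphRec.Multigraph (Fin 11),
        g = ⟨11, m⟩ ∧ m.degree = 18 ∧ ¬ GraphRec.IsAlgRec K m} ∧
    Module.finrank K (GraphRec.simpleComponent (GraphRec.Rec K 13) 17) <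
      Module.finrank K (GraphRec.simpleComponent (GraphRec.Inv K 13) 17) ∧
    ∃ m : GraphRec.Multigraph (Fin 13),
      m.IsSimple ∧ m.degree = 17 ∧ ¬ GraphRec.IsAlgRec K m := by
  have hRec : Module.finrank K (GraphRec.component (GraphRec.Rec K 11) 18) ≤ GraphRec.fCount 11 18 := by
    rw [GraphRec.fCount_eq 11 18 (by norm_num)]
    exact GraphRec.finrank_component_Rec_le 18
  have hInv : Module.finrank K (GraphRec.component (GraphRec.Inv K 11) 18) = GraphRec.hCount 11 18 := by
    rw [GraphRec.hCount_eq, GraphRec.finrank_component_Inv]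
  have hlt : GraphRec.fCount 11 18 < GraphRec.hCount 11 18 := by
    rw [GraphRec.fCount_eq 11 18 (by norm_num), GraphRec.hCount_eq, ← GraphRec.classNum_true_eq]
    exact GraphRec.multisetNum_lt_classNum_mult
  have hcount := (GraphRec.hCount_le (K := K) 11 18).trans (Nat.add_le_add_right hRec _)
  have hsimple := (GraphRec.finrank_simpleComponent_Rec_le (K := K) (n := 13) 17).trans_lt
    GraphRec.multisetNum_lt_classNum_simple
  refine ⟨hRec, hInv ▸ hlt, hInv, lt_of_le_of_ne GraphRec.Rec_le_Inv fun h => ?_, ?_, hcount,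
    hsimple.trans_le (GraphRec.classNum_simple_le_finrank _ _ fun m _ _ => GraphRec.orbitSum_mem_Inv m), ?_⟩
  · rw [h, hInv] at hRec
    omega
  -- If every multigraph were reconstructible, the last term of `hcount` would be zero and `h ≤ f`
  -- would follow.
  · by_contra h
    have hempty : {g : Σ N : ℕ, GraphRec.Multigraph (Fin N) | ∃ m : GraphRec.Multigraph (Fin 11),
        g = ⟨11, m⟩ ∧ m.degree = 18 ∧ ¬ GraphRec.IsAlgRec K m} = ∅ := by
      rw [Set.eq_empty_iff_forall_notMem]
      rintro g ⟨m, -, hm⟩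
      exact h ⟨m, hm⟩
    rw [hempty, GraphRec.classCount, Set.image_empty, Set.ncard_empty] at hcount
    omega
  -- If every simple graph with 17 edges were reconstructible, the image of `Rec` would have at
  -- least as large a dimension as the number of such graphs, against `hsimple`.
  · by_contra h
    refine absurd (GraphRec.classNum_simple_le_finrank (GraphRec.Rec K 13) 17 fun m hm hd => ?_)
      (Nat.not_le.2 hsimple)
    by_contra hrec
    exact h ⟨m, hm, hd, hrec⟩
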